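/- Conventions. Manifolds are finite-dimensional, real, smooth, Hausdorff and without boundary (second countability is not needed). For a Lie group $G$ with identity $e$, $\mathrm{Lie}(G)=T_eG$ carries the Lie bracket of left-invariant vector fields, and $\exp:\mathrm{Lie}(G)\to G$ is given by $\exp(\xi)=\gamma(1)$, where $\gamma$ is the integral curve with $\gamma(0)=e$ of the left-invariant vector field with value $\xi$ at $e$. Let $\pi:E\to\mathcal M$ be a smooth real vector bundle of finite rank over a manifold $\mathcal M$, let $G$ be a Lie group, and let $\Theta:E\times G\to E$ be a smooth fiber-linear right action: $\Theta$ is smooth, $\Theta(v,e)=v$, $\Theta(\Theta(v,g),h)=\Theta(v,gh)$, and there is a right action $\theta$ of $G$ on $\mathcal M$ such that every $\Theta_g=\Theta(\cdot,g)$ maps each fiber $E_p$ linearly into $E_{\theta(p,g)}$; write $\theta_g=\theta(\cdot,g)$. Let $\Sigma(E)$ be the space of all (not necessarily continuous) sections of $E$ with the topology of pointwise convergence. For $g\in G$ and $F\in\Sigma(E)$ put $$\mathcal K_gF=\Theta_{g^{-1}}\circ F\circ\theta_g\in\Sigma(E),\qquad \mathrm{Sym}_G(F)=\{g\in G:\mathcal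 K_gF=F\},$$ which is a subgroup of $G$. For $\xi\in\mathrm{Lie}(G)$ let $$\mathcal L_\xi F=\lim_{t\to0}\frac1t\bigl(\mathcal K_{\exp(t\xi)}F-F\bigr),$$ with domain $D(\mathcal L_\xi)\subset\Sigma(E)$ the set of those $F$ for which this limit exists in $\Sigma(E)$. Theorem. Let $F$ be a continuous section of $E$. Then $\mathrm{Sym}_G(F)$ is a closed subset of $G$ and an embedded Lie subgroup of $G$: with the subspace topology it carries a smooth structure for which it is a Lie group and the inclusion $\iota:\mathrm{Sym}_G(F)\hookrightarrow G$ is a smooth embedding. Its Lie algebra, the range of $D\iota(e)$ in $\mathrm{Lie}(G)$, is a Lie subalgebra of $\mathrm{Lie}(G)$ and equals $$\{\xi\in\mathrm{Lie}(G):F\in D(\mathcal L_\xi)\text{ and }\mathcal L_\xi F=0\}.$$ -/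

import Mathlib

open Set Filter Topology Bundle Manifold
open scoped ContDiff

noncomputable section

/-! ### The exponential map of a Lie group -/

section Exponential

variable {EG : Type*} [NormedAddCommGroup EG] [NormedSpace ℝ EG]
  {G : Type*} [TopologicalSpace G] [ChartedSpace EG G] [Group G]

instance lieGroupMinSmoothnessThree [LieGroup 𝓘(ℝ, EG) ∞ G] :
    LieGroup 𝓘(ℝ, EG) (minSmoothness ℝ 3) G := by
  rw [minSmoothness_of_isRCLikeNormedField]
  infer_instance

theorem contMDiff_one_mulInvariantVectorField [LieGroup 𝓘(ℝ, EG) ∞ G]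
    (ξ : GroupLieAlgebra 𝓘(ℝ, EG) G) :
    ContMDiff 𝓘(ℝ, EG) 𝓘(ℝ, EG).tangent 1
      (fun g : G => (⟨g, mulInvariantVectorField ξ g⟩ : TangentBundle 𝓘(ℝ, EG) G)) := by
  have h := contMDiff_mulInvariantVectorField (I := 𝓘(ℝ, EG)) (G := G) ξ
  exact h.of_le (one_le_two.trans le_minSmoothness)

theorem mfderiv_mul_left_mulInvariantVectorField [LieGroup 𝓘(ℝ, EG) ∞ G]
    (ξ : GroupLieAlgebra 𝓘(ℝ, EG) G) (g h : G) :
    mfderiv 𝓘(ℝ, EG) 𝓘(ℝ, EG) (g * ·) h (mulInvariantVectorField ξ h) =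
      mulInvariantVectorField ξ (g * h) := by
  have d (a b : G) : MDifferentiableAt 𝓘(ℝ, EG) 𝓘(ℝ, EG) (a * ·) b :=
    (contMDiff_mul_left (I := 𝓘(ℝ, EG)) (n := ∞) (a := a)).mdifferentiable (by simp) b
  have e : (fun x : G => g * h * x) = (g * ·) ∘ (h * ·) := by
    funext x
    simp [mul_assoc]
  have c := mfderiv_comp (I := 𝓘(ℝ, EG)) (I' := 𝓘(ℝ, EG)) (I'' := 𝓘(ℝ, EG)) (1 : G)
    (g := (g * ·)) (f := (h * ·)) (by simpa using d g (h * 1)) (d h 1)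
  have key : ∀ (k : G) (_ : h * 1 = k) (X : EG),
      (mfderiv 𝓘(ℝ, EG) 𝓘(ℝ, EG) (g * ·) (h * 1) X : EG) =
        mfderiv 𝓘(ℝ, EG) 𝓘(ℝ, EG) (g * ·) k X := by
    rintro _ rfl X
    rfl
  have r : mulInvariantVectorField ξ (g * h) =
      mfderiv 𝓘(ℝ, EG) 𝓘(ℝ, EG) (g * ·) (h * 1)
        (mfderiv 𝓘(ℝ, EG) 𝓘(ℝ, EG) (h * ·) (1 : G) ξ) := by
    unfold mulInvariantVectorField
    rw [e, c]
    rfl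
  rw [r]
  exact (key h (mul_one h) _).symm

/-- Left-invariant vector fields on a Lie group are complete. -/
theorem exists_integralCurve_mulInvariantVectorField [FiniteDimensional ℝ EG] [T2Space G]
    [LieGroup 𝓘(ℝ, EG) ∞ G] (ξ : GroupLieAlgebra 𝓘(ℝ, EG) G) :
    ∃ γ : ℝ → G, γ 0 = 1 ∧ IsMIntegralCurve γ (mulInvariantVectorField ξ) := by
  have : CompleteSpace EG := FiniteDimensional.complete ℝ EG
  have : IsManifold 𝓘(ℝ, EG) 1 G := IsManifold.of_le (n := ∞) (by simp)
  have hv := contMDiff_one_mulInvariantVectorField (G := G) ξ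
  obtain ⟨γ, h0, hγ⟩ := exists_isMIntegralCurveAt_of_contMDiffAt_boundaryless 0
    (hv.contMDiffAt (x := (1 : G)))
  rw [isMIntegralCurveAt_iff'] at hγ
  obtain ⟨ε, hε, hγ⟩ := hγ
  refine exists_isMIntegralCurve_of_isMIntegralCurveOn hv hε (fun g => ?_) 1
  refine ⟨fun t => g * γ t, by simp [h0], fun t ht => ?_⟩
  have ht' : t ∈ Metric.ball (0 : ℝ) ε := by
    simpa [Real.ball_eq_Ioo] using ht
  have hd := (hγ t ht').hasMFDerivAt (Metric.isOpen_ball.mem_nhds ht')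
  have hL : HasMFDerivAt 𝓘(ℝ, EG) 𝓘(ℝ, EG) (g * ·) (γ t)
      (mfderiv 𝓘(ℝ, EG) 𝓘(ℝ, EG) (g * ·) (γ t)) :=
    ((contMDiff_mul_left (I := 𝓘(ℝ, EG)) (n := ∞) (a := g)).mdifferentiable
      (by simp) (γ t)).hasMFDerivAt
  refine (((hL.comp t hd).congr_mfderiv ?_).hasMFDerivWithinAt)
  refine ContinuousLinearMap.ext fun (c : ℝ) => ?_
  change mfderiv 𝓘(ℝ, EG) 𝓘(ℝ, EG) (g * ·) (γ t) (c • mulInvariantVectorField ξ (γ t)) =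
    c • mulInvariantVectorField ξ (g * γ t)
  rw [map_smul, mfderiv_mul_left_mulInvariantVectorField]

variable [FiniteDimensional ℝ EG] [T2Space G] [LieGroup 𝓘(ℝ, EG) ∞ G]

/-- The exponential map of a Lie group: `lieExp ξ = γ 1`, where `γ` is the integral curve with
`γ 0 = 1` of the left-invariant vector field that takes the value `ξ` at the identity. -/
def lieExp (ξ : GroupLieAlgebra 𝓘(ℝ, EG) G) : G :=
  (exists_integralCurve_mulInvariantVectorField ξ).choose 1

end Exponential

/-! ### Embedded Lie subgroups -/

section Subgroup

variable {EG : Type*} [NormedAddCommGroup EG] [NormedSpace ℝ EG]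
  {G : Type*} [TopologicalSpace G] [ChartedSpace EG G] [Group G]

/-- The structure of an embedded Lie subgroup on a subgroup `H` of a Lie group `G`: a smooth
structure on `H`, for the subspace topology, for which `H` is a Lie group and the inclusion of `H`
in `G` is a smooth embedding. -/
structure EmbeddedLieSubgroupStructure (H : Subgroup G) where
  dim : ℕ
  chartedSpace : ChartedSpace (EuclideanSpace ℝ (Fin dim)) H
  lieGroup : LieGroup (𝓡 dim) ∞ H
  isSmoothEmbedding : IsSmoothEmbedding (𝓡 dim) 𝓘(ℝ, EG) ∞ (Subtype.val : H → G)

/-- The Lie algebra of an embedded Lie subgroup `H`, as a subset of the Lie algebra of `G`: the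
range of the derivative at the identity of the inclusion of `H` in `G`. -/
def EmbeddedLieSubgroupStructure.lieAlgebra {H : Subgroup G}
    (S : EmbeddedLieSubgroupStructure (EG := EG) H) : Set (GroupLieAlgebra 𝓘(ℝ, EG) G) :=
  letI := S.chartedSpace
  Set.range (mfderiv (𝓡 S.dim) 𝓘(ℝ, EG) (Subtype.val : H → G) 1)

end Subgroup

/-! ### Fiber-linear actions on vector bundles -/

/-- A smooth fiber-linear right action of a Lie group `G` on a smooth vector bundle `E` over `M`.
The action `(v, g) ↦ Θ (v, g)` on the total space is the map
`((p, v), g) ↦ (base p g, fiberMap p g v)`, where `base` is the induced right action on `M`. -/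
structure FiberLinearAction {EM : Type*} [NormedAddCommGroup EM] [NormedSpace ℝ EM]
    {M : Type*} [TopologicalSpace M] [ChartedSpace EM M]
    (W : Type*) [NormedAddCommGroup W] [NormedSpace ℝ W]
    (E : M → Type*) [∀ p, AddCommGroup (E p)] [∀ p, Module ℝ (E p)]
    [∀ p, TopologicalSpace (E p)] [TopologicalSpace (TotalSpace W E)] [FiberBundle W E]
    {EG : Type*} [NormedAddCommGroup EG] [NormedSpace ℝ EG]
    (G : Type*) [TopologicalSpace G] [ChartedSpace EG G] [Group G] where
  base : M → G → M
  fiberMap : ∀ (p : M) (g : G), E p →ₗ[ℝ] E (base p g)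
  contMDiff_total :
    ContMDiff ((𝓘(ℝ, EM).prod 𝓘(ℝ, W)).prod 𝓘(ℝ, EG)) (𝓘(ℝ, EM).prod 𝓘(ℝ, W)) ∞
      (fun x : TotalSpace W E × G =>
        (⟨base x.1.proj x.2, fiberMap x.1.proj x.2 x.1.snd⟩ : TotalSpace W E))
  total_one : ∀ v : TotalSpace W E,
    (⟨base v.proj 1, fiberMap v.proj 1 v.snd⟩ : TotalSpace W E) = v
  total_mul : ∀ (v : TotalSpace W E) (g h : G),
    (⟨base (base v.proj g) h, fiberMap (base v.proj g) h (fiberMap v.proj g v.snd)⟩ :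
      TotalSpace W E) = ⟨base v.proj (g * h), fiberMap v.proj (g * h) v.snd⟩

namespace FiberLinearAction

variable {EM : Type*} [NormedAddCommGroup EM] [NormedSpace ℝ EM]
  {M : Type*} [TopologicalSpace M] [ChartedSpace EM M]
  {W : Type*} [NormedAddCommGroup W] [NormedSpace ℝ W]
  {E : M → Type*} [∀ p, AddCommGroup (E p)] [∀ p, Module ℝ (E p)]
  [∀ p, TopologicalSpace (E p)] [TopologicalSpace (TotalSpace W E)] [FiberBundle W E]
  {EG : Type*} [NormedAddCommGroup EG] [NormedSpace ℝ EG]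
  {G : Type*} [TopologicalSpace G] [ChartedSpace EG G] [Group G]
  (A : FiberLinearAction (EM := EM) W E (EG := EG) G)

/-- The action `Θ` on the total space. -/
def total (v : TotalSpace W E) (g : G) : TotalSpace W E :=
  ⟨A.base v.proj g, A.fiberMap v.proj g v.snd⟩

theorem base_one (p : M) : A.base p 1 = p :=
  congrArg TotalSpace.proj (A.total_one ⟨p, 0⟩)

theorem base_mul (p : M) (g h : G) : A.base (A.base p g) h = A.base p (g * h) :=
  congrArg TotalSpace.proj (A.total_mul ⟨p, 0⟩ g h)

theorem base_base_inv (p : M) (g : G) : A.base (A.base p g) g⁻¹ = p := by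
  rw [A.base_mul, mul_inv_cancel, A.base_one]

/-- The operator `K_g` on (arbitrary) sections, `K_g F = Θ_{g⁻¹} ∘ F ∘ θ_g`. The value at `p` lies
in the fiber over `θ_{g⁻¹} (θ_g p)`, that is, in the fiber over `p`; see `mk_transform`. -/
def transform (g : G) (F : ∀ p, E p) (p : M) : E p :=
  A.base_base_inv p g ▸ A.fiberMap (A.base p g) g⁻¹ (F (A.base p g))

theorem mk_transform (g : G) (F : ∀ p, E p) (p : M) :
    (⟨p, A.transform g F p⟩ : TotalSpace W E) =
      A.total ⟨A.base p g, F (A.base p g)⟩ g⁻¹ := by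
  have key : ∀ (q : M) (h : q = p) (v : E q),
      (⟨p, h ▸ v⟩ : TotalSpace W E) = ⟨q, v⟩ := by
    rintro q rfl v
    rfl
  exact key _ (A.base_base_inv p g) _

theorem transform_one (F : ∀ p, E p) : A.transform 1 F = F := by
  funext p
  have h := A.mk_transform 1 F p
  rw [inv_one, total, A.total_one, A.base_one] at h
  exact TotalSpace.mk_injective p h

theorem transform_mul (g h : G) (F : ∀ p, E p) :
    A.transform (g * h) F = A.transform g (A.transform h F) := by
  funext p
  apply TotalSpace.mk_injective (F := W) p
  rw [A.mk_transform, A.mk_transform g, A.mk_transform h, mul_inv_rev, ← A.base_mul]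
  exact (A.total_mul _ _ _).symm

/-- The symmetry group `Sym_G(F) = {g : K_g F = F}` of a section `F`. -/
def symmetryGroup (F : ∀ p, E p) : Subgroup G where
  carrier := {g | A.transform g F = F}
  one_mem' := A.transform_one F
  mul_mem' {g h} hg hh := by
    simp only [mem_ofPred_eq] at hg hh ⊢
    rw [A.transform_mul, hh, hg]
  inv_mem' {g} hg := by
    simp only [mem_ofPred_eq] at hg ⊢
    conv_lhs => rw [← hg]
    rw [← A.transform_mul, inv_mul_cancel, A.transform_one]

variable [FiniteDimensional ℝ EG] [T2Space G] [LieGroup 𝓘(ℝ, EG) ∞ G]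

/-- The difference quotient `t⁻¹ (K_{exp(tξ)} F - F)`. -/
def lieQuotient (ξ : GroupLieAlgebra 𝓘(ℝ, EG) G) (F : ∀ p, E p) (t : ℝ) : ∀ p, E p :=
  t⁻¹ • (A.transform (lieExp (t • ξ)) F - F)

/-- The domain `D(L_ξ)` of the Lie derivative: the sections for which the difference quotient
converges as `t → 0`, in the space of all sections with the topology of pointwise convergence. -/
def lieDerivDomain (ξ : GroupLieAlgebra 𝓘(ℝ, EG) G) : Set (∀ p, E p) :=
  {F | ∃ L : ∀ p, E p, Tendsto (A.lieQuotient ξ F) (𝓝[≠] 0) (𝓝 L)}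

/-- The Lie derivative `L_ξ F`, the limit of the difference quotient (for `F ∈ D(L_ξ)`). -/
def lieDeriv (ξ : GroupLieAlgebra 𝓘(ℝ, EG) G) (F : ∀ p, E p) : ∀ p, E p :=
  limUnder (𝓝[≠] 0) (A.lieQuotient ξ F)

end FiberLinearAction

end

/-! For fixed `p` the map `g ↦ K_g F (p)` is continuous into the Hausdorff fiber over `p`, so the
symmetry group is an intersection of closed sets (`isClosed_symmetryGroup`). The rest combines
Cartan's closed subgroup theorem with the fact that a curve with zero derivative is constant.

For a closed subgroup `H`, let `𝔥` be the set of `ξ` whose one-parameter subgroup lies in `H`. The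
key is `expCurve_mem_of_tendsto`: if elements of `H` approach the identity with rescaled chart
coordinates tending to `σ`, then `σ ∈ 𝔥`, because suitable powers of these elements converge to
`exp(tσ)`. Applied to `exp(tξ) exp(tη)`, it shows that `𝔥` is closed under addition. Together with
compactness of the unit sphere it shows that, near the identity, `H` has no nontrivial element in
the directions of a complement of `𝔥`. Multiplying a parametrization of `H` along `𝔥` by a
transversal then gives a chart in which `H` is the subspace `𝔥` (`exists_isSliceChart`). Its left
translates make `H` an embedded Lie group with Lie algebra `𝔥`. In this chart the left-invariant
fields with values in `𝔥` at the identity are tangent to `𝔥` along `𝔥`, hence so are their brackets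
(`mlieBracket_mem`).

Finally, the derivative of `t ↦ K_{exp(tξ)} F (p)` at any time is a linear image of a value of `L_ξ
F`, so `L_ξ F = 0` holds exactly when `exp(tξ)` is a symmetry for all `t`
(`mem_lieDerivDomain_and_lieDeriv_eq_zero_iff`). -/

/-! ### One-parameter subgroups -/

section ExpCurve

variable {EG : Type*} [NormedAddCommGroup EG] [NormedSpace ℝ EG] [FiniteDimensional ℝ EG]
  {G : Type*} [TopologicalSpace G] [T2Space G] [ChartedSpace EG G] [Group G]
  [LieGroup 𝓘(ℝ, EG) ∞ G]

/-- The one-parameter subgroup with initial velocity `ξ`. -/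
noncomputable def expCurve (ξ : GroupLieAlgebra 𝓘(ℝ, EG) G) : ℝ → G :=
  (exists_integralCurve_mulInvariantVectorField ξ).choose

theorem expCurve_zero (ξ : GroupLieAlgebra 𝓘(ℝ, EG) G) : expCurve ξ 0 = 1 :=
  (exists_integralCurve_mulInvariantVectorField ξ).choose_spec.1

theorem isMIntegralCurve_expCurve (ξ : GroupLieAlgebra 𝓘(ℝ, EG) G) :
    IsMIntegralCurve (expCurve ξ) (mulInvariantVectorField ξ) :=
  (exists_integralCurve_mulInvariantVectorField ξ).choose_spec.2

omit [FiniteDimensional ℝ EG] [T2Space G] in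
theorem IsMIntegralCurve.mul_left {ξ : GroupLieAlgebra 𝓘(ℝ, EG) G} {γ : ℝ → G}
    (hγ : IsMIntegralCurve γ (mulInvariantVectorField ξ)) (g : G) :
    IsMIntegralCurve (fun t => g * γ t) (mulInvariantVectorField ξ) := by
  intro t
  have hL : HasMFDerivAt 𝓘(ℝ, EG) 𝓘(ℝ, EG) (g * ·) (γ t)
      (mfderiv 𝓘(ℝ, EG) 𝓘(ℝ, EG) (g * ·) (γ t)) :=
    ((contMDiff_mul_left (I := 𝓘(ℝ, EG)) (n := ∞) (a := g)).mdifferentiable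
      (by simp) (γ t)).hasMFDerivAt
  refine (hL.comp t (hγ t)).congr_mfderiv ?_
  refine ContinuousLinearMap.ext fun (c : ℝ) => ?_
  change mfderiv 𝓘(ℝ, EG) 𝓘(ℝ, EG) (g * ·) (γ t) (c • mulInvariantVectorField ξ (γ t)) =
    c • mulInvariantVectorField ξ (g * γ t)
  rw [map_smul, mfderiv_mul_left_mulInvariantVectorField]

/-- Uniqueness of integral curves. The group law and the scaling law below follow by exhibiting
translated, shifted or rescaled curves as integral curves starting at the identity. -/
theorem eq_expCurve {ξ : GroupLieAlgebra 𝓘(ℝ, EG) G} {γ : ℝ → G}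
    (hγ : IsMIntegralCurve γ (mulInvariantVectorField ξ)) (h0 : γ 0 = 1) : γ = expCurve ξ := by
  have : CompleteSpace EG := FiniteDimensional.complete ℝ EG
  have : IsManifold 𝓘(ℝ, EG) 1 G := IsManifold.of_le (n := ∞) (by simp)
  exact isMIntegralCurve_Ioo_eq_of_contMDiff_boundaryless (t₀ := 0)
    (contMDiff_one_mulInvariantVectorField (G := G) ξ) hγ (isMIntegralCurve_expCurve ξ)
    (by rw [h0, expCurve_zero])

theorem expCurve_add (ξ : GroupLieAlgebra 𝓘(ℝ, EG) G) (s t : ℝ) :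
    expCurve ξ (s + t) = expCurve ξ s * expCurve ξ t := by
  have h1 : IsMIntegralCurve (fun t => (expCurve ξ s)⁻¹ * expCurve ξ (t + s))
      (mulInvariantVectorField ξ) :=
    ((isMIntegralCurve_expCurve ξ).comp_add s).mul_left _
  have h := congrFun (eq_expCurve h1 (by simp)) t
  rw [← h, add_comm, mul_inv_cancel_left]

theorem expCurve_neg (ξ : GroupLieAlgebra 𝓘(ℝ, EG) G) (t : ℝ) :
    expCurve ξ (-t) = (expCurve ξ t)⁻¹ := by
  rw [eq_inv_iff_mul_eq_one, ← expCurve_add, neg_add_cancel, expCurve_zero]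

theorem expCurve_nsmul (ξ : GroupLieAlgebra 𝓘(ℝ, EG) G) (n : ℕ) (t : ℝ) :
    expCurve ξ (n * t) = expCurve ξ t ^ n := by
  induction n with
  | zero => simp [expCurve_zero]
  | succ n ih => rw [pow_succ, ← ih, ← expCurve_add]; push_cast; ring_nf

theorem expCurve_smul (ξ : GroupLieAlgebra 𝓘(ℝ, EG) G) (a t : ℝ) :
    expCurve (a • ξ) t = expCurve ξ (t * a) := by
  have h1 : IsMIntegralCurve (expCurve ξ ∘ (· * a)) (mulInvariantVectorField (a • ξ)) := by
    rw [mulInvariantVectorField_smul]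
    exact (isMIntegralCurve_expCurve ξ).comp_mul a
  exact (congrFun (eq_expCurve h1 (by simp [expCurve_zero])) t).symm

/-- Turns the difference quotient in `lieQuotient` into one along a single one-parameter subgroup.
-/
theorem lieExp_smul (ξ : GroupLieAlgebra 𝓘(ℝ, EG) G) (t : ℝ) :
    lieExp (t • ξ) = expCurve ξ t := by
  change expCurve (t • ξ) 1 = _
  rw [expCurve_smul, one_mul]

theorem continuous_expCurve (ξ : GroupLieAlgebra 𝓘(ℝ, EG) G) : Continuous (expCurve ξ) :=
  (isMIntegralCurve_expCurve ξ).continuous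

end ExpCurve

/-! ### A chart centered at the identity -/

section IdentityChart

variable (EG : Type*) [NormedAddCommGroup EG]
  (G : Type*) [TopologicalSpace G] [ChartedSpace EG G] [Group G]

/-- The preferred chart at the identity, translated so that it maps the identity to `0`. -/
def identityChart : OpenPartialHomeomorph G EG :=
  (chartAt EG (1 : G)).transHomeomorph (Homeomorph.addRight (-(chartAt EG (1 : G) 1)))

theorem identityChart_apply (g : G) :
    identityChart EG G g = chartAt EG (1 : G) g + -(chartAt EG (1 : G) 1) := rfl

theorem identityChart_symm_apply (x : EG) :
    (identityChart EG G).symm x = (chartAt EG (1 : G)).symm (x + (chartAt EG (1 : G) 1)) := by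
  simp [identityChart, Homeomorph.addRight_symm]

theorem identityChart_one : identityChart EG G 1 = 0 := by
  simp [identityChart_apply]

theorem one_mem_identityChart_source : 1 ∈ (identityChart EG G).source :=
  mem_chart_source EG (1 : G)

theorem identityChart_symm_zero : (identityChart EG G).symm 0 = 1 := by
  rw [← identityChart_one EG G, (identityChart EG G).left_inv (one_mem_identityChart_source EG G)]

theorem zero_mem_identityChart_target : 0 ∈ (identityChart EG G).target := by
  rw [← identityChart_one EG G]
  exact (identityChart EG G).map_source (one_mem_identityChart_source EG G)

variable [NormedSpace ℝ EG]

theorem identityChart_mem_maximalAtlas [IsManifold 𝓘(ℝ, EG) ∞ G] :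
    identityChart EG G ∈ IsManifold.maximalAtlas 𝓘(ℝ, EG) ∞ G := by
  rw [IsManifold.mem_maximalAtlas_iff_contMDiffOn]
  constructor
  · have h1 : ContMDiff 𝓘(ℝ, EG) 𝓘(ℝ, EG) ∞ (fun x : EG => x + -(chartAt EG (1 : G) 1)) :=
      (contDiff_id.add contDiff_const).contMDiff
    exact h1.comp_contMDiffOn (contMDiffOn_chart (I := 𝓘(ℝ, EG)) (n := ∞) (x := (1 : G)))
  · have h1 : ContMDiff 𝓘(ℝ, EG) 𝓘(ℝ, EG) ∞ (fun x : EG => x + chartAt EG (1 : G) 1) :=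
      (contDiff_id.add contDiff_const).contMDiff
    refine ((contMDiffOn_chart_symm (I := 𝓘(ℝ, EG)) (n := ∞) (x := (1 : G))).comp
      h1.contMDiffOn ?_).congr fun x _ => identityChart_symm_apply EG G x
    intro x hx
    simpa [identityChart, Homeomorph.addRight_symm] using hx

/-- The tangent space at the identity is identified with `EG` through the preferred chart there, and
a translation does not change derivatives. Vectors of the Lie algebra can therefore be read directly
as coordinate vectors. -/
theorem hasMFDerivAt_identityChart [IsManifold 𝓘(ℝ, EG) ∞ G] :
    HasMFDerivAt 𝓘(ℝ, EG) 𝓘(ℝ, EG) (identityChart EG G) 1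
      (ContinuousLinearMap.id ℝ EG) := by
  refine ⟨(identityChart EG G).continuousAt (one_mem_identityChart_source EG G), ?_⟩
  have h : HasFDerivAt (fun x : EG => x + -(chartAt EG (1 : G) 1))
      (ContinuousLinearMap.id ℝ EG) (chartAt EG (1 : G) 1) := (hasFDerivAt_id _).add_const _
  refine HasFDerivAt.hasFDerivWithinAt (𝕜 := ℝ) (E := EG) (F := EG)
    (h.congr_of_eventuallyEq ?_)
  filter_upwards [(chartAt EG (1 : G)).open_target.mem_nhds (mem_chart_target EG (1 : G))]
    with x hx
  simp [writtenInExtChartAt, chartAt_self_eq, identityChart_apply,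
    (chartAt EG (1 : G)).right_inv hx]

theorem contMDiffOn_identityChart [IsManifold 𝓘(ℝ, EG) ∞ G] :
    ContMDiffOn 𝓘(ℝ, EG) 𝓘(ℝ, EG) ∞ (identityChart EG G) (identityChart EG G).source :=
  contMDiffOn_of_mem_maximalAtlas (identityChart_mem_maximalAtlas EG G)

theorem contMDiffOn_identityChart_symm [IsManifold 𝓘(ℝ, EG) ∞ G] :
    ContMDiffOn 𝓘(ℝ, EG) 𝓘(ℝ, EG) ∞ (identityChart EG G).symm (identityChart EG G).target :=
  contMDiffOn_symm_of_mem_maximalAtlas (identityChart_mem_maximalAtlas EG G)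

end IdentityChart

/-! ### Group operations in the chart at the identity -/

section ChartCalculus

variable {EG : Type*} [NormedAddCommGroup EG] [NormedSpace ℝ EG]
  {G : Type*} [TopologicalSpace G] [ChartedSpace EG G] [Group G] [LieGroup 𝓘(ℝ, EG) ∞ G]
  {V : Type*} [NormedAddCommGroup V] [NormedSpace ℝ V]

theorem ContMDiffAt.contDiffAt_identityChart {f : V → G} {x : V}
    (hf : ContMDiffAt 𝓘(ℝ, V) 𝓘(ℝ, EG) ∞ f x) (hx : f x ∈ (identityChart EG G).source) :
    ContDiffAt ℝ ∞ (fun y => identityChart EG G (f y)) x := by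
  have h := (contMDiffOn_identityChart EG G).contMDiffAt
    ((identityChart EG G).open_source.mem_nhds hx)
  exact (h.comp x hf).contDiffAt

theorem ContMDiffAt.identityChart_symm {f : V → EG} {x : V} (hf : ContDiffAt ℝ ∞ f x)
    (hx : f x ∈ (identityChart EG G).target) :
    ContMDiffAt 𝓘(ℝ, V) 𝓘(ℝ, EG) ∞ (fun y => (identityChart EG G).symm (f y)) x :=
  ((contMDiffOn_identityChart_symm EG G).contMDiffAt
    ((identityChart EG G).open_target.mem_nhds hx)).comp x hf.contMDiffAt

variable (EG G)

/-- The smooth map `(u, c, w) ↦ u (c w c⁻¹)` equals `u` at `w = 0`, so a local Lipschitz constant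
bounds its deviation from `u`. This controls one step of the induction on powers. -/
theorem exists_norm_identityChart_mul_conj_sub_le :
    ∃ K : ℝ, 0 ≤ K ∧ ∃ δ > 0, ∀ u c w : EG, ‖u‖ < δ → ‖c‖ < δ → ‖w‖ < δ →
      (identityChart EG G).symm u * ((identityChart EG G).symm c * (identityChart EG G).symm w *
        ((identityChart EG G).symm c)⁻¹) ∈ (identityChart EG G).source ∧
      ‖identityChart EG G ((identityChart EG G).symm u * ((identityChart EG G).symm c *
        (identityChart EG G).symm w * ((identityChart EG G).symm c)⁻¹)) - u‖ ≤ K * ‖w‖ := by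
  set φ := identityChart EG G with hφ
  let f : EG × EG × EG → G := fun p => φ.symm p.1 * (φ.symm p.2.1 * φ.symm p.2.2 *
    (φ.symm p.2.1)⁻¹)
  have h0 := zero_mem_identityChart_target EG G
  have hf : ContMDiffAt 𝓘(ℝ, EG × EG × EG) 𝓘(ℝ, EG) ∞ f 0 := by
    have h1 := ContMDiffAt.identityChart_symm (G := G) (f := fun p : EG × EG × EG => p.1) (x := 0)
      contDiff_fst.contDiffAt h0
    have h2 := ContMDiffAt.identityChart_symm (G := G) (f := fun p : EG × EG × EG => p.2.1) (x := 0)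
      (contDiff_fst.comp contDiff_snd).contDiffAt h0
    have h3 := ContMDiffAt.identityChart_symm (G := G) (f := fun p : EG × EG × EG => p.2.2) (x := 0)
      (contDiff_snd.comp contDiff_snd).contDiffAt h0
    exact h1.mul ((h2.mul h3).mul h2.inv)
  have hf0 : f 0 = 1 := by simp [f, hφ, identityChart_symm_zero]
  have hf0' : f 0 ∈ φ.source := hf0 ▸ one_mem_identityChart_source EG G
  obtain ⟨K, t, ht, hK⟩ := ((hf.contDiffAt_identityChart hf0').of_le
    (m := 1) (by simp)).exists_lipschitzOnWith
  have ht' : {p : EG × EG × EG | f p ∈ φ.source} ∈ 𝓝 0 :=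
    hf.continuousAt.preimage_mem_nhds (φ.open_source.mem_nhds hf0')
  have hT : {p : EG × EG × EG | p.1 ∈ φ.target} ∈ 𝓝 0 :=
    continuous_fst.continuousAt.preimage_mem_nhds (φ.open_target.mem_nhds h0)
  obtain ⟨δ, hδ, hb⟩ := Metric.mem_nhds_iff.1 (inter_mem ht (inter_mem ht' hT))
  refine ⟨K, K.2, δ, hδ, fun u c w hu hc hw => ?_⟩
  have m1 : (u, c, w) ∈ Metric.ball (0 : EG × EG × EG) δ := by simp [hu, hc, hw]
  have m2 : (u, c, (0 : EG)) ∈ Metric.ball (0 : EG × EG × EG) δ := by simp [hu, hc]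
  refine ⟨(hb m1).2.1, ?_⟩
  have h := hK.dist_le_mul _ (hb m1).1 _ (hb m2).1
  have e : φ (f (u, c, (0 : EG))) = u := by
    simp only [f]
    rw [identityChart_symm_zero, mul_one, mul_inv_cancel, mul_one, φ.right_inv (hb m2).2.2]
  rw [dist_eq_norm, e, dist_eq_norm] at h
  simpa [Prod.norm_def] using h

/-- The smooth map `(x, y) ↦ x y⁻¹` is the identity of the group on the diagonal; the bound is the
Lipschitz estimate between `(x, y)` and `(y, y)`. -/
theorem exists_norm_identityChart_mul_inv_le :
    ∃ K : ℝ, 0 ≤ K ∧ ∃ δ > 0, ∀ x y : EG, ‖x‖ < δ → ‖y‖ < δ →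
      (identityChart EG G).symm x * ((identityChart EG G).symm y)⁻¹ ∈
        (identityChart EG G).source ∧
      ‖identityChart EG G ((identityChart EG G).symm x * ((identityChart EG G).symm y)⁻¹)‖ ≤
        K * ‖x - y‖ := by
  set φ := identityChart EG G with hφ
  let f : EG × EG → G := fun p => φ.symm p.1 * (φ.symm p.2)⁻¹
  have h0 := zero_mem_identityChart_target EG G
  have hf : ContMDiffAt 𝓘(ℝ, EG × EG) 𝓘(ℝ, EG) ∞ f 0 := by
    have h1 := ContMDiffAt.identityChart_symm (G := G) (f := fun p : EG × EG => p.1) (x := 0)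
      contDiff_fst.contDiffAt h0
    have h2 := ContMDiffAt.identityChart_symm (G := G) (f := fun p : EG × EG => p.2) (x := 0)
      contDiff_snd.contDiffAt h0
    exact h1.mul h2.inv
  have hf0 : f 0 = 1 := by simp [f]
  have hf0' : f 0 ∈ φ.source := hf0 ▸ one_mem_identityChart_source EG G
  obtain ⟨K, t, ht, hK⟩ := ((hf.contDiffAt_identityChart hf0').of_le
    (m := 1) (by simp)).exists_lipschitzOnWith
  have ht' : {p : EG × EG | f p ∈ φ.source} ∈ 𝓝 0 :=
    hf.continuousAt.preimage_mem_nhds (φ.open_source.mem_nhds hf0')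
  obtain ⟨δ, hδ, hb⟩ := Metric.mem_nhds_iff.1 (inter_mem ht ht')
  refine ⟨K, K.2, δ, hδ, fun x y hx hy => ?_⟩
  have m1 : (x, y) ∈ Metric.ball (0 : EG × EG) δ := by simp [hx, hy]
  have m2 : (y, y) ∈ Metric.ball (0 : EG × EG) δ := by simp [hy]
  refine ⟨(hb m1).2, ?_⟩
  have h := hK.dist_le_mul _ (hb m1).1 _ (hb m2).1
  have e : φ (f (y, y)) = 0 := by
    simp only [f, mul_inv_cancel]
    exact identityChart_one EG G
  rw [dist_eq_norm, e, dist_eq_norm, sub_zero] at h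
  simpa [Prod.norm_def] using h

/-- Multiplication, in the chart at the identity. -/
def chartMul (p : EG × EG) : EG :=
  identityChart EG G ((identityChart EG G).symm p.1 * (identityChart EG G).symm p.2)

theorem contDiffAt_chartMul {p : EG × EG} (h1 : p.1 ∈ (identityChart EG G).target)
    (h2 : p.2 ∈ (identityChart EG G).target)
    (h : (identityChart EG G).symm p.1 * (identityChart EG G).symm p.2 ∈
      (identityChart EG G).source) :
    ContDiffAt ℝ ∞ (chartMul EG G) p :=
  ((ContMDiffAt.identityChart_symm (G := G) contDiff_fst.contDiffAt h1).mul
    (ContMDiffAt.identityChart_symm (G := G) contDiff_snd.contDiffAt h2)).contDiffAt_identityChart h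

theorem contDiffAt_chartMul_zero {x : EG} (h : x ∈ (identityChart EG G).target) :
    ContDiffAt ℝ ∞ (chartMul EG G) (x, 0) := by
  refine contDiffAt_chartMul EG G h (zero_mem_identityChart_target EG G) ?_
  rw [identityChart_symm_zero, mul_one]
  exact (identityChart EG G).map_target h

/-- Since `0` represents the unit, both partial maps are the identity near `0`, which determines the
derivative. -/
theorem hasFDerivAt_chartMul_zero :
    HasFDerivAt (chartMul EG G)
      (ContinuousLinearMap.fst ℝ EG EG + ContinuousLinearMap.snd ℝ EG EG) 0 := by
  have h0 := zero_mem_identityChart_target EG G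
  have hT := (identityChart EG G).open_target.mem_nhds h0
  have hd : HasFDerivAt (chartMul EG G) (fderiv ℝ (chartMul EG G) 0) 0 :=
    ((contDiffAt_chartMul_zero EG G h0).differentiableAt (by simp)).hasFDerivAt
  refine hd.congr_fderiv ?_
  have h1 : HasFDerivAt (fun x : EG => chartMul EG G (x, 0))
      ((fderiv ℝ (chartMul EG G) 0).comp (ContinuousLinearMap.inl ℝ EG EG)) 0 :=
    HasFDerivAt.comp (g := chartMul EG G) (0 : EG) (by simpa using! hd)
      (ContinuousLinearMap.inl ℝ EG EG).hasFDerivAt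
  have h2 : HasFDerivAt (fun x : EG => chartMul EG G (0, x))
      ((fderiv ℝ (chartMul EG G) 0).comp (ContinuousLinearMap.inr ℝ EG EG)) 0 :=
    HasFDerivAt.comp (g := chartMul EG G) (0 : EG) (by simpa using! hd)
      (ContinuousLinearMap.inr ℝ EG EG).hasFDerivAt
  have e1 := h1.unique ((hasFDerivAt_id (0 : EG)).congr_of_eventuallyEq (by
    filter_upwards [hT] with x hx
    simp [chartMul, identityChart_symm_zero, (identityChart EG G).right_inv hx]))
  have e2 := h2.unique ((hasFDerivAt_id (0 : EG)).congr_of_eventuallyEq (by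
    filter_upwards [hT] with x hx
    simp [chartMul, identityChart_symm_zero, (identityChart EG G).right_inv hx]))
  ext x
  · simpa using DFunLike.congr_fun e1 x
  · simpa using DFunLike.congr_fun e2 x

variable {EG G}

theorem HasFDerivAt.identityChart_mul {f g : V → G} {f' g' : V →L[ℝ] EG} {x : V}
    (hf : HasFDerivAt (fun y => identityChart EG G (f y)) f' x)
    (hg : HasFDerivAt (fun y => identityChart EG G (g y)) g' x)
    (hfc : ContinuousAt f x) (hgc : ContinuousAt g x) (hf1 : f x = 1) (hg1 : g x = 1) :
    HasFDerivAt (fun y => identityChart EG G (f y * g y)) (f' + g') x := by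
  have h1 := one_mem_identityChart_source EG G
  have hS := (identityChart EG G).open_source.mem_nhds h1
  have h : HasFDerivAt (fun y => chartMul EG G (identityChart EG G (f y), identityChart EG G (g y)))
      ((ContinuousLinearMap.fst ℝ EG EG + ContinuousLinearMap.snd ℝ EG EG).comp (f'.prod g')) x := by
    refine HasFDerivAt.comp (g := chartMul EG G) x ?_ (hf.prodMk hg)
    rw [hf1, hg1, identityChart_one]
    exact hasFDerivAt_chartMul_zero EG G
  have e : (ContinuousLinearMap.fst ℝ EG EG + ContinuousLinearMap.snd ℝ EG EG).comp (f'.prod g') =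
      f' + g' := by
    ext; simp
  rw [e] at h
  refine h.congr_of_eventuallyEq ?_
  filter_upwards [hfc.preimage_mem_nhds (hf1 ▸ hS), hgc.preimage_mem_nhds (hg1 ▸ hS)] with y hy hy'
  simp only [chartMul]
  rw [(identityChart EG G).left_inv hy, (identityChart EG G).left_inv hy']

end ChartCalculus

/-! ### Smoothness of one-parameter subgroups -/

section ExpCurveSmooth

variable {EG : Type*} [NormedAddCommGroup EG] [NormedSpace ℝ EG] [FiniteDimensional ℝ EG]
  {G : Type*} [TopologicalSpace G] [T2Space G] [ChartedSpace EG G] [Group G]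
  [LieGroup 𝓘(ℝ, EG) ∞ G]

theorem hasDerivAt_identityChart_expCurve (ξ : GroupLieAlgebra 𝓘(ℝ, EG) G) :
    HasDerivAt (fun t => identityChart EG G (expCurve ξ t)) (ξ : EG) 0 := by
  have key : ∀ g : G, g = 1 → (mulInvariantVectorField ξ g : EG) = ξ := by
    rintro _ rfl
    have : (fun x : G => 1 * x) = id := by ext; simp
    rw [mulInvariantVectorField, this, mfderiv_id]
    rfl
  have h1 := isMIntegralCurve_expCurve ξ 0
  have h2 : HasMFDerivAt 𝓘(ℝ, EG) 𝓘(ℝ, EG) (identityChart EG G) (expCurve ξ 0)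
      (ContinuousLinearMap.id ℝ EG) := by
    have h := hasMFDerivAt_identityChart EG G
    rwa [← expCurve_zero ξ] at h
  have h3 : HasFDerivAt (fun t => identityChart EG G (expCurve ξ t))
      ((ContinuousLinearMap.id ℝ EG).comp ((1 : ℝ →L[ℝ] ℝ).smulRight
        (mulInvariantVectorField ξ (expCurve ξ 0) : EG))) 0 := (h2.comp 0 h1).hasFDerivAt
  refine h3.hasDerivAt.congr_deriv ?_
  rw [key _ (expCurve_zero ξ)]
  exact one_smul ℝ (ξ : EG)

/-- In the chart the curve solves an autonomous equation with smooth right-hand side, so it is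
smooth near `0`; the group law carries this to every time. -/
theorem contMDiff_expCurve (ξ : GroupLieAlgebra 𝓘(ℝ, EG) G) :
    ContMDiff 𝓘(ℝ, ℝ) 𝓘(ℝ, EG) ∞ (expCurve ξ) := by
  have : CompleteSpace EG := FiniteDimensional.complete ℝ EG
  set φ := identityChart EG G
  have h0 : expCurve ξ 0 ∈ φ.source := by
    rw [expCurve_zero]
    exact one_mem_identityChart_source EG G
  have hS : expCurve ξ ⁻¹' φ.source ∈ 𝓝 (0 : ℝ) :=
    (continuous_expCurve ξ).continuousAt.preimage_mem_nhds (φ.open_source.mem_nhds h0)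
  obtain ⟨ε, hε, hb⟩ := Metric.nhds_basis_closedBall.mem_iff.1 hS
  rw [Real.closedBall_eq_Icc, zero_sub, zero_add] at hb
  -- The left-invariant field in the chart, written as a partial derivative of the multiplication so
  -- that its smoothness is visible.
  let X : EG → EG := fun x => fderiv ℝ (chartMul EG G) (x, 0) (0, ξ)
  have hX : ContDiffOn ℝ ∞ X φ.target := fun x hx => by
    have h := (contDiffAt_chartMul_zero EG G hx).fderiv_right (m := ∞) (by simp)
    have h' : ContDiffAt ℝ ∞ (fun x : EG => fderiv ℝ (chartMul EG G) (x, 0)) x :=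
      ContDiffAt.comp (f := fun x : EG => (x, (0 : EG))) x h
        (contDiff_id.prodMk contDiff_const).contDiffAt
    exact (h'.clm_apply contDiffAt_const).contDiffWithinAt
  have hd : ∀ t ∈ Icc (-ε) ε, HasDerivAt (fun t => φ (expCurve ξ t)) (X (φ (expCurve ξ t))) t := by
    intro t ht
    have ht' := hb ht
    have hm := ((contDiffAt_chartMul_zero EG G (φ.map_source ht')).differentiableAt
      (by simp)).hasFDerivAt
    have hpair : HasDerivAt (fun s => (φ (expCurve ξ t), φ (expCurve ξ s))) ((0 : EG), (ξ : EG)) 0 :=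
      (hasDerivAt_const _ _).prodMk (hasDerivAt_identityChart_expCurve ξ)
    have hc : HasDerivAt (fun s => chartMul EG G (φ (expCurve ξ t), φ (expCurve ξ s)))
        (X (φ (expCurve ξ t))) 0 := by
      refine HasFDerivAt.comp_hasDerivAt (l := chartMul EG G) (0 : ℝ) ?_ hpair
      rw [expCurve_zero, identityChart_one]
      exact hm
    have hc' : HasDerivAt (fun s => φ (expCurve ξ (t + s))) (X (φ (expCurve ξ t))) 0 := by
      refine hc.congr_of_eventuallyEq ?_
      filter_upwards [hS] with s hs
      simp only [chartMul]
      rw [φ.left_inv ht', φ.left_inv hs, expCurve_add]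
    have := HasDerivAt.comp_sub_const t t (f := fun s => φ (expCurve ξ (t + s)))
      (by simpa using hc')
    simpa using this
  have hsm : ContDiffOn ℝ ∞ (fun t => φ (expCurve ξ t)) (Icc (-ε) ε) :=
    ODE.contDiffOn_enat_Icc_of_hasDerivWithinAt (n := ⊤) (f := fun _ => X) (u := φ.target)
      (hX.comp contDiffOn_snd fun p hp => hp.2) (fun t ht => (hd t ht).hasDerivWithinAt)
      fun t ht => φ.map_source (hb ht)
  have hsm0 : ContMDiffAt 𝓘(ℝ, ℝ) 𝓘(ℝ, EG) ∞ (expCurve ξ) 0 := by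
    have h := ContMDiffAt.identityChart_symm (G := G)
      (hsm.contDiffAt (Icc_mem_nhds (neg_lt_zero.2 hε) hε)) (φ.map_source h0)
    refine h.congr_of_eventuallyEq ?_
    filter_upwards [hS] with t ht
    exact (φ.left_inv ht).symm
  intro t
  have hsub : ContMDiffAt 𝓘(ℝ, ℝ) 𝓘(ℝ, ℝ) ∞ (fun s : ℝ => s - t) t :=
    (contDiff_id.sub contDiff_const).contMDiff.contMDiffAt
  have hcomp : ContMDiffAt 𝓘(ℝ, ℝ) 𝓘(ℝ, EG) ∞ (fun s => expCurve ξ (s - t)) t :=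
    ContMDiffAt.comp t (by rwa [sub_self]) hsub
  refine ((contMDiffAt_const (c := expCurve ξ t)).mul hcomp).congr_of_eventuallyEq ?_
  refine Eventually.of_forall fun s => ?_
  rw [Pi.mul_apply, ← expCurve_add, add_sub_cancel]

end ExpCurveSmooth

/-! ### Tangent directions of closed subgroups -/

section TangentDirections

variable {EG : Type*} [NormedAddCommGroup EG] [NormedSpace ℝ EG] [FiniteDimensional ℝ EG]
  {G : Type*} [TopologicalSpace G] [T2Space G] [ChartedSpace EG G] [Group G]
  [LieGroup 𝓘(ℝ, EG) ∞ G]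

-- Membership in the source is needed because the chart has arbitrary values elsewhere.
omit [NormedSpace ℝ EG] [FiniteDimensional ℝ EG] [T2Space G] [LieGroup 𝓘(ℝ, EG) ∞ G] in
theorem tendsto_one_of_identityChart {ι : Type*} {l : Filter ι} {u : ι → G}
    (hu : ∀ᶠ i in l, u i ∈ (identityChart EG G).source)
    (h : Tendsto (fun i => identityChart EG G (u i)) l (𝓝 0)) : Tendsto u l (𝓝 1) := by
  have hc := (identityChart EG G).continuousAt_symm (zero_mem_identityChart_target EG G)
  rw [ContinuousAt, identityChart_symm_zero] at hc
  refine (hc.comp h).congr' ?_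
  filter_upwards [hu] with i hi
  exact (identityChart EG G).left_inv hi

variable (EG G) in
/-- Comparison of the powers of `h` with a one-parameter subgroup `γ`, as long as the latter stays
near the identity. -/
theorem exists_norm_identityChart_pow_mul_inv_le :
    ∃ K : ℝ, 0 ≤ K ∧ ∃ δ > 0, ∀ (ξ : GroupLieAlgebra 𝓘(ℝ, EG) G) (T : ℝ) (h : G) (s : ℝ),
      0 < s →
      (∀ t ∈ Icc 0 T, expCurve ξ t ∈ (identityChart EG G).source ∧
        ‖identityChart EG G (expCurve ξ t)‖ < δ) →
      h * (expCurve ξ s)⁻¹ ∈ (identityChart EG G).source →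
      ‖identityChart EG G (h * (expCurve ξ s)⁻¹)‖ < δ →
      (T / s) * (K * ‖identityChart EG G (h * (expCurve ξ s)⁻¹)‖) < δ →
      ∀ k : ℕ, k * s ≤ T →
        h ^ k * (expCurve ξ (k * s))⁻¹ ∈ (identityChart EG G).source ∧
        ‖identityChart EG G (h ^ k * (expCurve ξ (k * s))⁻¹)‖ ≤
          k * (K * ‖identityChart EG G (h * (expCurve ξ s)⁻¹)‖) := by
  obtain ⟨K, hK, δ, hδ, H⟩ := exists_norm_identityChart_mul_conj_sub_le EG G
  refine ⟨K, hK, δ, hδ, fun ξ T h s hs hγ hw hwδ hT k => ?_⟩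
  set φ := identityChart EG G
  set w := h * (expCurve ξ s)⁻¹ with hwdef
  induction k with
  | zero =>
    intro _
    simp [expCurve_zero, one_mem_identityChart_source, φ, identityChart_one]
  | succ k ih =>
    intro hk
    push_cast at hk ⊢
    have hk' : k * s ≤ T := by nlinarith
    obtain ⟨hu, hub⟩ := ih hk'
    set u := h ^ k * (expCurve ξ (k * s))⁻¹ with hudef
    obtain ⟨hc, hcδ⟩ := hγ (k * s) ⟨by positivity, hk'⟩
    have hkT : (k : ℝ) ≤ T / s := (le_div_iff₀ hs).2 hk'
    -- The accumulated error stays below `δ`, so the one-step estimate still applies at stage `k`.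
    have huδ : ‖φ u‖ < δ :=
      (hub.trans (mul_le_mul_of_nonneg_right hkT (by positivity))).trans_lt hT
    have key := H (φ u) (φ (expCurve ξ (k * s))) (φ w) huδ hcδ hwδ
    rw [φ.left_inv hu, φ.left_inv hc, φ.left_inv hw] at key
    -- Telescoping: one more factor `h` multiplies the error `u` by a conjugate of `w`, at a cost of
    -- at most `K * ‖φ w‖`.
    have e : u * (expCurve ξ (k * s) * w * (expCurve ξ (k * s))⁻¹) =
        h ^ (k + 1) * (expCurve ξ ((k + 1) * s))⁻¹ := by
      have : ((k : ℝ) + 1) * s = k * s + s := by ring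
      rw [this, expCurve_add, hudef, hwdef]
      group
    rw [e] at key
    refine ⟨key.1, ?_⟩
    calc _ ≤ ‖φ u‖ + K * ‖φ w‖ := by
          have := norm_sub_norm_le (φ (h ^ (k + 1) * (expCurve ξ ((k + 1) * s))⁻¹)) (φ u)
          linarith [key.2]
      _ ≤ _ := by linarith

/-- A limit `σ` of directions `φ (h n) / s n`, where the `h n` lie in a closed subgroup and tend to
the identity, generates a one-parameter subgroup of the closed subgroup. -/
theorem expCurve_mem_of_tendsto {H : Subgroup G} (hH : IsClosed (H : Set G)) {h : ℕ → G}
    {s : ℕ → ℝ} {σ : GroupLieAlgebra 𝓘(ℝ, EG) G} (hmem : ∀ n, h n ∈ H) (hs : ∀ n, 0 < s n)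
    (hs0 : Tendsto s atTop (𝓝 0)) (h1 : Tendsto h atTop (𝓝 1))
    (hσ : Tendsto (fun n => (s n)⁻¹ • identityChart EG G (h n)) atTop (𝓝 (σ : EG))) (t : ℝ) :
    expCurve σ t ∈ H := by
  have : IsTopologicalGroup G := topologicalGroup_of_lieGroup 𝓘(ℝ, EG) ∞
  set φ := identityChart EG G with hφ
  obtain ⟨K, hK, δ, hδ, hpow⟩ := exists_norm_identityChart_pow_mul_inv_le EG G
  obtain ⟨K', hK', δ', hδ', hdiv⟩ := exists_norm_identityChart_mul_inv_le EG G
  have hS : φ.source ∈ 𝓝 (1 : G) := φ.open_source.mem_nhds (one_mem_identityChart_source EG G)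
  have hφc : Tendsto φ (𝓝 1) (𝓝 0) := by
    have := φ.continuousAt (one_mem_identityChart_source EG G)
    rwa [ContinuousAt, hφ, identityChart_one] at this
  have hγ1 : Tendsto (expCurve σ) (𝓝 0) (𝓝 1) := by
    simpa [ContinuousAt, expCurve_zero] using (continuous_expCurve σ).continuousAt (x := (0 : ℝ))
  have hγn : Tendsto (fun n => expCurve σ (s n)) atTop (𝓝 1) := hγ1.comp hs0
  have hslope : Tendsto (fun n => (s n)⁻¹ • φ (expCurve σ (s n))) atTop (𝓝 (σ : EG)) := by
    have h := (hasDerivAt_iff_tendsto_slope_zero.1 (hasDerivAt_identityChart_expCurve σ)).comp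
      (tendsto_nhdsWithin_iff.2 ⟨hs0, Eventually.of_forall fun n => (hs n).ne'⟩)
    refine h.congr fun n => ?_
    simp [expCurve_zero, identityChart_one, φ]
  have hw : ∀ᶠ n in atTop, h n * (expCurve σ (s n))⁻¹ ∈ φ.source ∧
      ‖φ (h n * (expCurve σ (s n))⁻¹)‖ ≤ K' * ‖φ (h n) - φ (expCurve σ (s n))‖ := by
    have hball : Metric.ball (0 : EG) δ' ∈ 𝓝 (0 : EG) := Metric.ball_mem_nhds _ hδ'
    filter_upwards [h1 hS, hγn hS, (hφc.comp h1) hball, (hφc.comp hγn) hball] with n a b c d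
    have key := hdiv (φ (h n)) (φ (expCurve σ (s n))) (by simpa using c) (by simpa using d)
    rwa [φ.left_inv a, φ.left_inv b] at key
  -- The elements `h n` and `exp(s n σ)` agree to first order in `s n`: their quotient has
  -- coordinates of size `o(s n)`. About `T / s n` multiplications thus produce a total error
  -- tending to `0`.
  have hsmall : Tendsto (fun n => (s n)⁻¹ * (K * ‖φ (h n * (expCurve σ (s n))⁻¹)‖)) atTop
      (𝓝 0) := by
    have h2 : Tendsto (fun n => K * (K' * ‖(s n)⁻¹ • φ (h n) - (s n)⁻¹ • φ (expCurve σ (s n))‖))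
        atTop (𝓝 0) := by
      have h5 : Tendsto (fun n => (s n)⁻¹ • φ (h n) - (s n)⁻¹ • φ (expCurve σ (s n))) atTop
          (𝓝 (0 : EG)) := by
        convert hσ.sub hslope
        exact (sub_self (G := EG) σ).symm
      simpa using (h5.norm.const_mul K').const_mul K
    refine squeeze_zero' (Eventually.of_forall fun n => ?_) ?_ h2
    · have := (hs n).le
      positivity
    · filter_upwards [hw] with n hn
      rw [← smul_sub, norm_smul, norm_inv, Real.norm_of_nonneg (hs n).le]
      have h3 := mul_le_mul_of_nonneg_left hn.2 hK
      have h4 := mul_le_mul_of_nonneg_left h3 (inv_nonneg.2 (hs n).le)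
      linarith
  have hw1 : Tendsto (fun n => φ (h n * (expCurve σ (s n))⁻¹)) atTop (𝓝 0) := by
    have := h1.mul hγn.inv
    rw [inv_one, mul_one] at this
    exact hφc.comp this
  obtain ⟨T, hT, hTb⟩ : ∃ T > 0, ∀ t ∈ Icc 0 T, expCurve σ t ∈ φ.source ∧
      ‖φ (expCurve σ t)‖ < δ := by
    have h2 : ∀ᶠ t in 𝓝 (0 : ℝ), expCurve σ t ∈ φ.source ∧ ‖φ (expCurve σ t)‖ < δ := by
      filter_upwards [hγ1 hS, (hφc.comp hγ1) (Metric.ball_mem_nhds _ hδ)] with t ht ht'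
      exact ⟨ht, by simpa using ht'⟩
    obtain ⟨T, hT, hb⟩ := Metric.nhds_basis_closedBall.mem_iff.1 h2
    refine ⟨T, hT, fun t ht => hb ?_⟩
    rw [Real.closedBall_eq_Icc]
    exact ⟨by linarith [ht.1], by linarith [ht.2]⟩
  have hmain : ∀ t ∈ Icc 0 T, expCurve σ t ∈ H := by
    intro t ht
    -- The exponent `⌊t / s n⌋₊` is chosen so that the elapsed time `⌊t / s n⌋₊ * s n` tends to `t`.
    have hks : Tendsto (fun n => (⌊t / s n⌋₊ : ℝ) * s n) atTop (𝓝 t) := by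
      have lower : Tendsto (fun n => t - s n) atTop (𝓝 t) := by simpa using hs0.const_sub t
      refine tendsto_of_tendsto_of_tendsto_of_le_of_le lower tendsto_const_nhds ?_ ?_
      · intro n
        have := Nat.lt_floor_add_one (t / s n)
        rw [div_lt_iff₀ (hs n)] at this
        change t - s n ≤ _
        linarith
      · intro n
        exact (le_div_iff₀ (hs n)).1 (Nat.floor_le (div_nonneg ht.1 (hs n).le))
    have hkle : ∀ n, (⌊t / s n⌋₊ : ℝ) * s n ≤ T := fun n =>
      ((le_div_iff₀ (hs n)).1 (Nat.floor_le (div_nonneg ht.1 (hs n).le))).trans ht.2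
    have hTs : Tendsto (fun n => T / s n * (K * ‖φ (h n * (expCurve σ (s n))⁻¹)‖)) atTop
        (𝓝 0) := by
      have := hsmall.const_mul T
      rw [mul_zero] at this
      exact this.congr fun n => by ring
    have hu : ∀ᶠ n in atTop,
        h n ^ ⌊t / s n⌋₊ * (expCurve σ (⌊t / s n⌋₊ * s n))⁻¹ ∈ φ.source ∧
        ‖φ (h n ^ ⌊t / s n⌋₊ * (expCurve σ (⌊t / s n⌋₊ * s n))⁻¹)‖ ≤
          T / s n * (K * ‖φ (h n * (expCurve σ (s n))⁻¹)‖) := by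
      filter_upwards [hw, hTs.eventually_lt_const hδ,
        hw1.norm.eventually_lt_const (by simpa using hδ)] with n hn hn' hn''
      obtain ⟨a, b⟩ := hpow σ T (h n) (s n) (hs n) hTb hn.1 hn'' hn' _ (hkle n)
      exact ⟨a, b.trans (mul_le_mul_of_nonneg_right ((le_div_iff₀ (hs n)).2 (hkle n))
        (by positivity))⟩
    have hu1 : Tendsto (fun n => h n ^ ⌊t / s n⌋₊ * (expCurve σ (⌊t / s n⌋₊ * s n))⁻¹) atTop
        (𝓝 1) :=
      tendsto_one_of_identityChart (hu.mono fun n hn => hn.1)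
        (squeeze_zero_norm' (hu.mono fun n hn => hn.2) hTs)
    have hlim := hu1.mul (((continuous_expCurve σ).tendsto t).comp hks)
    rw [one_mul] at hlim
    refine hH.mem_of_tendsto hlim (Eventually.of_forall fun n => ?_)
    simpa using H.pow_mem (hmem n) _
  -- Any `t ≥ 0` is a multiple `m * (t / m)` with `t / m ≤ T`; negative times follow by inversion.
  have hpos : ∀ t, 0 ≤ t → expCurve σ t ∈ H := by
    intro t ht
    obtain ⟨m, hm⟩ := exists_nat_gt (t / T)
    have hm0 : (0 : ℝ) < m := lt_of_le_of_lt (by positivity) hm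
    have e : t = m * (t / m) := by field_simp
    rw [e, expCurve_nsmul]
    refine H.pow_mem (hmain _ ⟨by positivity, ?_⟩) m
    rw [div_le_iff₀ hm0]
    rw [div_lt_iff₀ hT] at hm
    linarith
  rcases le_total 0 t with ht | ht
  · exact hpos t ht
  · have := hpos (-t) (by linarith)
    rw [expCurve_neg] at this
    exact H.inv_mem_iff.1 this

/-- Curve version of the preceding criterion, obtained by sampling the curve along a sequence of
times. -/
theorem expCurve_mem_of_hasDerivAt {H : Subgroup G} (hH : IsClosed (H : Set G)) {c : ℝ → G}
    {σ : GroupLieAlgebra 𝓘(ℝ, EG) G} (hmem : ∀ᶠ t in 𝓝 0, c t ∈ H) (h0 : c 0 = 1)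
    (hc : ContinuousAt c 0)
    (hσ : HasDerivAt (fun t => identityChart EG G (c t)) (σ : EG) 0) (t : ℝ) :
    expCurve σ t ∈ H := by
  obtain ⟨ε, hε, hb⟩ := Metric.eventually_nhds_iff.1 hmem
  -- The factor `1 / 2` keeps every sample strictly inside the `ε`-ball, where the curve is known to
  -- lie in `H`.
  let s : ℕ → ℝ := fun n => ε / 2 / (n + 1)
  have hs : ∀ n, 0 < s n := fun n => by positivity
  have hs0 : Tendsto s atTop (𝓝 0) := by
    simpa [s, div_eq_mul_inv] using
      (tendsto_one_div_add_atTop_nhds_zero_nat (𝕜 := ℝ)).const_mul (ε / 2)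
  refine expCurve_mem_of_tendsto hH (h := fun n => c (s n)) (s := s) (fun n => hb ?_) hs hs0 ?_ ?_ t
  · rw [Real.dist_0_eq_abs, abs_of_pos (hs n)]
    have : s n ≤ ε / 2 := div_le_self (by positivity) (by linarith [n.cast_nonneg (α := ℝ)])
    linarith
  · rw [ContinuousAt, h0] at hc
    exact hc.comp hs0
  · have h := (hasDerivAt_iff_tendsto_slope_zero.1 hσ).comp
      (tendsto_nhdsWithin_iff.2 ⟨hs0, Eventually.of_forall fun n => (hs n).ne'⟩)
    refine h.congr fun n => ?_
    simp [h0, identityChart_one]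

/-- The Lie algebra of a closed subgroup `H`, as a subspace: the `ξ` that generate a one-parameter
subgroup of `H`. -/
def Subgroup.expSubmodule (H : Subgroup G) (hH : IsClosed (H : Set G)) :
    Submodule ℝ (GroupLieAlgebra 𝓘(ℝ, EG) G) where
  carrier := {ξ | ∀ t, expCurve ξ t ∈ H}
  zero_mem' t := by
    have := expCurve_smul (0 : GroupLieAlgebra 𝓘(ℝ, EG) G) 0 t
    rw [smul_zero, mul_zero, expCurve_zero] at this
    rw [this]
    exact H.one_mem
  smul_mem' a ξ hξ t := by
    rw [expCurve_smul]
    exact hξ _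
  add_mem' {ξ η} hξ hη t := by
    have : IsTopologicalGroup G := topologicalGroup_of_lieGroup 𝓘(ℝ, EG) ∞
    -- The product curve lies in `H` and has velocity `ξ + η` at the identity, although it need not
    -- be a one-parameter subgroup.
    refine expCurve_mem_of_hasDerivAt hH (c := fun t => expCurve ξ t * expCurve η t)
      (Eventually.of_forall fun t => H.mul_mem (hξ t) (hη t)) (by simp [expCurve_zero])
      ((continuous_expCurve ξ).mul (continuous_expCurve η)).continuousAt ?_ t
    have h := (hasDerivAt_identityChart_expCurve ξ).hasFDerivAt.identityChart_mul
      (hasDerivAt_identityChart_expCurve η).hasFDerivAt (continuous_expCurve ξ).continuousAt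
      (continuous_expCurve η).continuousAt (expCurve_zero ξ) (expCurve_zero η)
    refine h.hasDerivAt.congr_deriv ?_
    exact congrArg₂ (fun x y : EG => x + y) (one_smul ℝ (ξ : EG)) (one_smul ℝ (η : EG))

end TangentDirections

/-! ### Slice charts for closed subgroups -/

section SliceChart

variable {EG : Type*} [NormedAddCommGroup EG] [NormedSpace ℝ EG]
  {G : Type*} [TopologicalSpace G] [ChartedSpace EG G] [Group G]

/-- A chart `e` at the identity of `G`, with derivative the identity, that maps the subgroup `H` to
the subspace `𝔥`. -/
structure IsSliceChart (H : Subgroup G) (𝔥 : Submodule ℝ EG) (e : OpenPartialHomeomorph G EG) :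
    Prop where
  mem_maximalAtlas : e ∈ IsManifold.maximalAtlas 𝓘(ℝ, EG) ∞ G
  one_mem_source : 1 ∈ e.source
  map_one : e 1 = 0
  hasMFDerivAt : HasMFDerivAt 𝓘(ℝ, EG) 𝓘(ℝ, EG) e 1 (ContinuousLinearMap.id ℝ EG)
  mem_iff : ∀ g ∈ e.source, g ∈ H ↔ e g ∈ 𝔥

variable [FiniteDimensional ℝ EG] [T2Space G] [LieGroup 𝓘(ℝ, EG) ∞ G]

/-- The map is the product of the elements `exp(ℓ i x • b i)`, that is, coordinates of the second
kind. At `0` derivatives of products add, so the order of the factors plays no role there. -/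
theorem exists_contMDiff_map_mem_subgroup {H : Subgroup G} {ι : Type*} (s : Finset ι)
    (ℓ : ι → EG →L[ℝ] ℝ) (b : ι → EG)
    (hb : ∀ i, ∀ t, expCurve (EG := EG) (G := G) (b i) t ∈ H) :
    ∃ f : EG → G, ContMDiff 𝓘(ℝ, EG) 𝓘(ℝ, EG) ∞ f ∧ (∀ x, f x ∈ H) ∧ f 0 = 1 ∧
      HasFDerivAt (fun x => identityChart EG G (f x)) (∑ i ∈ s, (ℓ i).smulRight (b i)) 0 := by
  classical
  induction s using Finset.induction_on with
  | empty =>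
    refine ⟨fun _ => 1, contMDiff_const, fun _ => H.one_mem, rfl, ?_⟩
    simpa using hasFDerivAt_const (identityChart EG G 1) (0 : EG)
  | insert i s hi ih =>
    obtain ⟨f, hf, hfH, hf0, hfd⟩ := ih
    have hc : ContMDiff 𝓘(ℝ, EG) 𝓘(ℝ, EG) ∞
        (fun x => expCurve (EG := EG) (G := G) (b i) (ℓ i x)) :=
      (contMDiff_expCurve _).comp (ℓ i).contDiff.contMDiff
    have hd : HasFDerivAt (fun x => identityChart EG G
        (expCurve (EG := EG) (G := G) (b i) (ℓ i x))) ((ℓ i).smulRight (b i)) 0 := by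
      have h1 : HasFDerivAt (fun t => identityChart EG G
          (expCurve (EG := EG) (G := G) (b i) t))
          (ContinuousLinearMap.toSpanSingleton ℝ (b i)) (ℓ i 0) := by
        rw [map_zero]
        exact (hasDerivAt_identityChart_expCurve (EG := EG) (G := G) (b i)).hasFDerivAt
      refine (h1.comp (0 : EG) (ℓ i).hasFDerivAt).congr_fderiv ?_
      ext x
      simp
    have h0 : expCurve (EG := EG) (G := G) (b i) (ℓ i 0) = 1 := by
      rw [map_zero]
      exact expCurve_zero (EG := EG) (G := G) (b i)
    refine ⟨fun x => expCurve (EG := EG) (G := G) (b i) (ℓ i x) * f x, hc.mul hf,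
      fun x => H.mul_mem (hb i _) (hfH x), (congrArg₂ (· * ·) h0 hf0).trans (mul_one 1), ?_⟩
    rw [Finset.sum_insert hi]
    exact hd.identityChart_mul hfd hc.continuous.continuousAt hf.continuous.continuousAt
      h0 hf0

/-- A subspace that contains no generator of a one-parameter subgroup of the closed subgroup `H`
meets `H` only at the identity, near the identity. -/
theorem eventually_identityChart_symm_notMem {H : Subgroup G} (hH : IsClosed (H : Set G))
    (𝔠 : Submodule ℝ EG)
    (h𝔠 : ∀ z ∈ 𝔠, (∀ t, expCurve (EG := EG) (G := G) z t ∈ H) → z = 0) :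
    ∀ᶠ z in 𝓝 (0 : EG), z ∈ 𝔠 → (identityChart EG G).symm z ∈ H → z = 0 := by
  by_contra hcon
  have : ProperSpace EG := FiniteDimensional.proper ℝ EG
  rw [not_eventually] at hcon
  have hT : (identityChart EG G).target ∈ 𝓝 (0 : EG) :=
    (identityChart EG G).open_target.mem_nhds (zero_mem_identityChart_target EG G)
  obtain ⟨z, hz0, hz⟩ := exists_seq_forall_of_frequently (hcon.and_eventually hT)
  have hz𝔠 : ∀ n, z n ∈ 𝔠 := fun n => by
    by_contra h
    exact (hz n).1 fun h' => absurd h' h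
  have hzH : ∀ n, (identityChart EG G).symm (z n) ∈ H := fun n => by
    by_contra h
    exact (hz n).1 fun _ h' => absurd h' h
  have hzne : ∀ n, z n ≠ 0 := fun n h => (hz n).1 fun _ _ => h
  -- Normalized counterexamples accumulate at a unit vector `σ ∈ 𝔠`. The tangent direction criterion
  -- with `s n = ‖z (ψ n)‖` puts `exp(tσ)` in `H`, which forces `σ = 0`.
  have hsph : ∀ n, ‖z n‖⁻¹ • z n ∈ Metric.sphere (0 : EG) 1 := fun n => by
    simp [norm_smul, hzne n]
  obtain ⟨σ, hσ, ψ, hψ, hlim⟩ := (isCompact_sphere (0 : EG) 1).tendsto_subseq hsph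
  have hσ𝔠 : σ ∈ 𝔠 := 𝔠.closed_of_finiteDimensional.mem_of_tendsto hlim
    (Eventually.of_forall fun n => 𝔠.smul_mem _ (hz𝔠 _))
  have hzψ := hz0.comp hψ.tendsto_atTop
  have hc := (identityChart EG G).continuousAt_symm (zero_mem_identityChart_target EG G)
  rw [ContinuousAt, identityChart_symm_zero] at hc
  have hσ0 := h𝔠 σ hσ𝔠 fun t =>
    expCurve_mem_of_tendsto hH (h := fun n => (identityChart EG G).symm (z (ψ n)))
      (s := fun n => ‖z (ψ n)‖) (fun n => hzH _) (fun n => norm_pos_iff.2 (hzne _))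
      (by simpa using hzψ.norm) (hc.comp hzψ)
      (hlim.congr fun n => by simp [(identityChart EG G).right_inv (hz (ψ n)).2]) t
  simp [hσ0] at hσ

/-- The inverse function theorem, with a local inverse that is smooth on an open set. -/
theorem exists_openPartialHomeomorph_contDiffOn {V : Type*} [NormedAddCommGroup V]
    [NormedSpace ℝ V] [CompleteSpace V] {f : V → V} {U : Set V} {a : V} (hU : IsOpen U)
    (ha : a ∈ U) (hf : ContDiffOn ℝ ∞ f U)
    (hfa : HasFDerivAt f (ContinuousLinearMap.id ℝ V) a) :
    ∃ R : OpenPartialHomeomorph V V, a ∈ R.source ∧ R.source ⊆ U ∧ (∀ x, R x = f x) ∧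
      ContDiffOn ℝ ∞ R.symm R.target ∧
      HasFDerivAt R.symm (ContinuousLinearMap.id ℝ V) (f a) := by
  have hfa' : HasFDerivAt f ((ContinuousLinearEquiv.refl ℝ V : V ≃L[ℝ] V) : V →L[ℝ] V) a := hfa
  have hca : ContDiffAt ℝ ∞ f a := hf.contDiffAt (hU.mem_nhds ha)
  let R₀ := hca.toOpenPartialHomeomorph f hfa' (by simp)
  have hR₀ : a ∈ R₀.source := hca.mem_toOpenPartialHomeomorph_source hfa' (by simp)
  -- Restricting to points with invertible derivative makes the local inverse smooth on its whole
  -- target rather than only at `f a`.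
  let O : Set V := U ∩ fderiv ℝ f ⁻¹' range ((↑) : (V ≃L[ℝ] V) → V →L[ℝ] V)
  have hO : IsOpen O := (hf.continuousOn_fderiv_of_isOpen hU (by simp)).isOpen_inter_preimage hU
    ContinuousLinearEquiv.isOpen
  have haO : a ∈ O := ⟨ha, ContinuousLinearEquiv.refl ℝ V, hfa.fderiv.symm⟩
  let R := R₀.restrOpen O hO
  have hRs : R.source = R₀.source ∩ O := rfl
  have hR : ∀ x, R x = f x := fun x => rfl
  have haR : a ∈ R.source := ⟨hR₀, haO⟩
  have hsymm : ∀ x ∈ R.source, ContDiffAt ℝ ∞ R.symm (f x) := by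
    intro x hx
    obtain ⟨A, hA⟩ := hx.2.2
    have hcx : ContDiffAt ℝ ∞ f x := hf.contDiffAt (hU.mem_nhds hx.2.1)
    have hl : R.symm (f x) = x := R.left_inv hx
    refine R.contDiffAt_symm (f₀' := A) (R.map_source hx) ?_ ?_
    · rw [hl, hA]
      exact (hcx.differentiableAt (by simp)).hasFDerivAt
    · rw [hl]
      exact hcx
  refine ⟨R, haR, fun x hx => hx.2.1, hR, fun y hy => ?_, ?_⟩
  · have h := hsymm _ (R.map_target hy)
    rw [← hR, R.right_inv hy] at h
    exact h.contDiffWithinAt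
  · have hl : R.symm (f a) = a := R.left_inv haR
    exact R.hasFDerivAt_symm (f' := ContinuousLinearEquiv.refl ℝ V) (R.map_source haR)
      (by rw [hl]; exact hfa)

/-- With `P₁` a projection onto `𝔥` and `Q = 1 - P₁`, the map `Ψ x = f x * φ⁻¹ (Q x)` has derivative
`P₁ + Q = 1` at `0`. As `f x ∈ H`, near `0` one has `Ψ x ∈ H` iff `φ⁻¹ (Q x) ∈ H`, iff `Q x = 0`,
iff `x ∈ 𝔥`. The chart is a local inverse of `Ψ`. -/
theorem exists_isSliceChart (H : Subgroup G) (hH : IsClosed (H : Set G)) :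
    ∃ (𝔥 : Submodule ℝ EG) (e : OpenPartialHomeomorph G EG), IsSliceChart H 𝔥 e ∧
      ∀ x : EG, x ∈ 𝔥 ↔ ∀ t, expCurve (EG := EG) (G := G) x t ∈ H := by
  have : CompleteSpace EG := FiniteDimensional.complete ℝ EG
  set φ := identityChart EG G with hφ
  let 𝔥 : Submodule ℝ EG := H.expSubmodule (EG := EG) hH
  have mem𝔥 : ∀ x : EG, x ∈ 𝔥 ↔ ∀ t, expCurve (EG := EG) (G := G) x t ∈ H :=
    fun x => Iff.rfl
  obtain ⟨P, hP⟩ := Submodule.ClosedComplemented.of_finiteDimensional 𝔥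
  let b := Module.finBasis ℝ 𝔥
  obtain ⟨f, hf, hfH, hf0, hfd⟩ := exists_contMDiff_map_mem_subgroup (H := H) Finset.univ
    (fun i => (LinearMap.toContinuousLinearMap (b.coord i)).comp P) (fun i => (b i : EG))
    (fun i => (mem𝔥 _).1 (b i).2)
  let P₁ : EG →L[ℝ] EG := 𝔥.subtypeL.comp P
  have hsum : (∑ i, ((LinearMap.toContinuousLinearMap (b.coord i)).comp P).smulRight (b i : EG)) =
      P₁ := by
    ext x
    have h := congrArg Subtype.val (b.sum_repr (P x))
    rw [Submodule.coe_sum] at h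
    rw [_root_.sum_apply]
    exact h
  rw [hsum] at hfd
  have hP₁ : ∀ x, P₁ x ∈ 𝔥 := fun x => (P x).2
  have hP₁𝔥 : ∀ x ∈ 𝔥, P₁ x = x := fun x hx => congrArg Subtype.val (hP ⟨x, hx⟩)
  let Q : EG →L[ℝ] EG := ContinuousLinearMap.id ℝ EG - P₁
  have hQ : ∀ x, Q x = x - P₁ x := fun x => rfl
  -- The kernel of `P₁` meets `𝔥` only in `0`, since `P₁` fixes `𝔥`.
  have hsmall := eventually_identityChart_symm_notMem hH (LinearMap.ker P₁.toLinearMap) (by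
    intro z hz hzH
    rw [← hP₁𝔥 z ((mem𝔥 z).2 hzH)]
    exact hz)
  obtain ⟨O, hOsub, hO, hO0⟩ := eventually_nhds_iff.1
    ((Q.continuous.tendsto' 0 0 (map_zero Q)).eventually hsmall)
  let Ψ : EG → G := fun x => f x * φ.symm (Q x)
  let U₀ : Set EG := O ∩ Q ⁻¹' φ.target
  have hU₀ : IsOpen U₀ := hO.inter (φ.open_target.preimage Q.continuous)
  have hΨ : ContMDiffOn 𝓘(ℝ, EG) 𝓘(ℝ, EG) ∞ Ψ U₀ := fun x hx =>
    (hf.contMDiffAt.mul (ContMDiffAt.identityChart_symm (G := G) Q.contDiff.contDiffAt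
      hx.2)).contMDiffWithinAt
  let U : Set EG := U₀ ∩ Ψ ⁻¹' φ.source
  have hU : IsOpen U := hΨ.continuousOn.isOpen_inter_preimage hU₀ φ.open_source
  have hΨ0 : Ψ 0 = 1 := by simp [Ψ, hf0, hφ, identityChart_symm_zero]
  have h0U : (0 : EG) ∈ U := by
    refine ⟨⟨hO0, ?_⟩, ?_⟩
    · rw [mem_preimage, map_zero]
      exact zero_mem_identityChart_target EG G
    · rw [mem_preimage, hΨ0]
      exact one_mem_identityChart_source EG G
  have hψ : ContDiffOn ℝ ∞ (fun x => φ (Ψ x)) U := fun x hx =>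
    ((hΨ.contMDiffAt (hU₀.mem_nhds hx.1)).contDiffAt_identityChart hx.2).contDiffWithinAt
  have hψ0 : HasFDerivAt (fun x => φ (Ψ x)) (ContinuousLinearMap.id ℝ EG) 0 := by
    have h2 : HasFDerivAt (fun x => φ (φ.symm (Q x))) Q 0 := by
      refine Q.hasFDerivAt.congr_of_eventuallyEq ?_
      filter_upwards [hU₀.mem_nhds h0U.1] with x hx
      exact φ.right_inv hx.2
    have h3 : ContinuousAt (fun x => φ.symm (Q x)) 0 :=
      (ContMDiffAt.identityChart_symm (G := G) Q.contDiff.contDiffAt h0U.1.2).continuousAt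
    refine (hfd.identityChart_mul h2 hf.continuous.continuousAt h3 hf0
      (by simp [hφ, identityChart_symm_zero])).congr_fderiv ?_
    simp [Q]
  obtain ⟨R, hR0, hRU, hR, hRs, hRd⟩ := exists_openPartialHomeomorph_contDiffOn hU h0U hψ hψ0
  have hψ00 : φ (Ψ 0) = 0 := by rw [hΨ0, hφ, identityChart_one]
  rw [hψ00] at hRd
  have h0t : (0 : EG) ∈ R.target := by
    have := R.map_source hR0
    rwa [hR, hψ00] at this
  have hRs0 : R.symm 0 = 0 := by
    have := R.left_inv hR0
    rwa [hR, hψ00] at this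
  have hφ1 : φ 1 = 0 := identityChart_one EG G
  refine ⟨𝔥, φ.trans R.symm, ⟨?_, ?_, ?_, ?_, ?_⟩, mem𝔥⟩
  · rw [IsManifold.mem_maximalAtlas_iff_contMDiffOn]
    constructor
    · exact hRs.contMDiffOn.comp ((contMDiffOn_identityChart EG G).mono inter_subset_left)
        fun g hg => hg.2
    · have hR' : ContMDiffOn 𝓘(ℝ, EG) 𝓘(ℝ, EG) ∞ R R.source :=
        (hψ.contMDiffOn.mono hRU).congr fun x _ => hR x
      exact (contMDiffOn_identityChart_symm EG G).comp (f := R)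
        (hR'.mono fun x hx => hx.1) fun x hx => hx.2
  · refine ⟨one_mem_identityChart_source EG G, ?_⟩
    change φ 1 ∈ R.target
    rwa [hφ1]
  · change R.symm (φ 1) = 0
    rw [hφ1, hRs0]
  · have h1 : HasMFDerivAt 𝓘(ℝ, EG) 𝓘(ℝ, EG) R.symm (φ 1) (ContinuousLinearMap.id ℝ EG) := by
      rw [hφ1]
      exact hRd.hasMFDerivAt
    exact h1.comp 1 (hasMFDerivAt_identityChart EG G)
  · intro g hg
    set x := R.symm (φ g) with hx
    have hxs : x ∈ R.source := R.map_target hg.2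
    have hgx : g = Ψ x := by
      have h1 : φ (Ψ x) = φ g := by
        rw [← hR]
        exact R.right_inv hg.2
      exact (φ.injOn (hRU hxs).2 hg.1 h1).symm
    change g ∈ H ↔ x ∈ 𝔥
    rw [hgx]
    constructor
    · intro h
      have h' : φ.symm (Q x) ∈ H := (H.mul_mem_cancel_left (hfH x)).1 h
      have h0 := hOsub x (hRU hxs).1.1 (by simp [hQ, hP₁𝔥 _ (hP₁ x)]) h'
      rw [hQ, sub_eq_zero] at h0
      rw [h0]
      exact hP₁ x
    · intro h
      have h0 : Q x = 0 := by rw [hQ, hP₁𝔥 x h, sub_self]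
      simp only [Ψ, h0, hφ, identityChart_symm_zero, mul_one]
      exact hfH x

end SliceChart

/-! ### The Lie group structure on a subgroup with a slice chart -/

namespace IsSliceChart

variable {EG : Type*} [NormedAddCommGroup EG] [NormedSpace ℝ EG]
  {G : Type*} [TopologicalSpace G] [ChartedSpace EG G] [Group G]
  {V : Type*} [NormedAddCommGroup V] [NormedSpace ℝ V]
  {H : Subgroup G} {𝔥 : Submodule ℝ EG} {e : OpenPartialHomeomorph G EG}
  (he : IsSliceChart H 𝔥 e) {L : V →L[ℝ] EG} {P : EG →L[ℝ] V}
  (hPL : Function.RightInverse L P) (hL : L.toLinearMap.range = 𝔥)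

include he hL

theorem symm_mem {v : V} (hv : L v ∈ e.target) : e.symm (L v) ∈ H := by
  rw [he.mem_iff _ (e.map_target hv), e.right_inv hv, ← hL]
  exact ⟨v, rfl⟩

include hPL

/-- `L` identifies the model space with `𝔥` and `P` is a left inverse of `L`, so `L ∘ P` fixes `𝔥`,
where `e` sends the points of `H`. -/
theorem map_proj {g : G} (hg : g ∈ e.source) (hgH : g ∈ H) : L (P (e g)) = e g := by
  have h := (he.mem_iff g hg).1 hgH
  rw [← hL] at h
  obtain ⟨v, hv⟩ := h
  have hv' : L v = e g := hv
  rw [← hv', hPL v]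

open Classical in
/-- The chart at the identity of `H` obtained by restricting the slice chart `e`. -/
noncomputable def subgroupChart : OpenPartialHomeomorph H V where
  toFun x := P (e x)
  -- The value `1` is a default that is never used on the target.
  invFun v := if hv : e.symm (L v) ∈ H then ⟨e.symm (L v), hv⟩ else 1
  source := {x | (x : G) ∈ e.source}
  target := {v | L v ∈ e.target}
  map_source' x hx := by
    rw [mem_ofPred_eq, he.map_proj hPL hL hx x.2]
    exact e.map_source hx
  map_target' v hv := by
    rw [dif_pos (he.symm_mem hL hv)]
    exact e.map_target hv
  left_inv' x hx := by
    apply Subtype.ext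
    simp only [he.map_proj hPL hL hx x.2, e.left_inv hx, SetLike.coe_mem, dite_true]
  right_inv' v hv := by
    rw [dif_pos (he.symm_mem hL hv)]
    change P (e (e.symm (L v))) = v
    rw [e.right_inv hv, hPL v]
  open_source := e.open_source.preimage continuous_subtype_val
  open_target := e.open_target.preimage L.continuous
  continuousOn_toFun := P.continuous.comp_continuousOn
    (e.continuousOn.comp continuous_subtype_val.continuousOn fun _ hx => hx)
  continuousOn_invFun := by
    rw [IsInducing.subtypeVal.continuousOn_iff]
    refine (e.continuousOn_symm.comp L.continuous.continuousOn fun _ hv => hv).congr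
      fun v hv => ?_
    simp only [Function.comp_apply]
    rw [dif_pos (he.symm_mem hL hv)]

theorem coe_subgroupChart_symm {v : V} (hv : L v ∈ e.target) :
    (((he.subgroupChart hPL hL).symm v : H) : G) = e.symm (L v) :=
  congrArg Subtype.val (dif_pos (he.symm_mem hL hv))

variable [IsTopologicalGroup G]

/-- The chart of `H` at `g` obtained by left-translating the chart at the identity. -/
noncomputable def translatedChart (g : H) : OpenPartialHomeomorph H V :=
  (Homeomorph.mulLeft g⁻¹).transOpenPartialHomeomorph (he.subgroupChart hPL hL)

theorem translatedChart_apply (g x : H) :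
    he.translatedChart hPL hL g x = P (e ((g : G)⁻¹ * x)) := rfl

theorem mem_translatedChart_source {g x : H} :
    x ∈ (he.translatedChart hPL hL g).source ↔ (g : G)⁻¹ * x ∈ e.source := Iff.rfl

theorem coe_translatedChart_symm (g : H) {v : V} (hv : L v ∈ e.target) :
    (((he.translatedChart hPL hL g).symm v : H) : G) = g * e.symm (L v) := by
  have h : (he.translatedChart hPL hL g).symm v =
      (Homeomorph.mulLeft g⁻¹).symm ((he.subgroupChart hPL hL).symm v) := rfl
  rw [h, Homeomorph.mulLeft_symm, inv_inv, ← he.coe_subgroupChart_symm hPL hL hv]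
  rfl

/-- The charted space structure on `H` obtained by left-translating the chart at the identity. -/
@[reducible]
noncomputable def chartedSpace : ChartedSpace V H where
  atlas := range (he.translatedChart hPL hL)
  chartAt g := he.translatedChart hPL hL g
  mem_chart_source g := by
    rw [he.mem_translatedChart_source hPL hL, inv_mul_cancel]
    exact he.one_mem_source
  chart_mem_atlas g := ⟨g, rfl⟩

variable [LieGroup 𝓘(ℝ, EG) ∞ G]

/-- A transition map is `L`, then a smooth map of `G` read in the chart `e`, then `P`. -/
theorem isManifold :
    letI := he.chartedSpace hPL hL
    IsManifold 𝓘(ℝ, V) ∞ H := by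
  let := he.chartedSpace hPL hL
  refine isManifold_of_contDiffOn 𝓘(ℝ, V) ∞ H ?_
  rintro _ _ ⟨g, rfl⟩ ⟨h, rfl⟩
  have heq : ∀ v, L v ∈ e.target → he.translatedChart hPL hL h
      ((he.translatedChart hPL hL g).symm v) = P (e ((h : G)⁻¹ * (g * e.symm (L v)))) := by
    intro v hv
    rw [he.translatedChart_apply hPL hL, he.coe_translatedChart_symm hPL hL g hv]
  intro v hv
  simp only [mfld_simps] at hv
  have hv1 : L v ∈ e.target := hv.1
  have hv2 : (h : G)⁻¹ * (g * e.symm (L v)) ∈ e.source := by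
    have := hv.2
    rwa [he.mem_translatedChart_source hPL hL, he.coe_translatedChart_symm hPL hL g hv1] at this
  have h1 : ContMDiffAt 𝓘(ℝ, V) 𝓘(ℝ, EG) ∞ (fun v => e.symm (L v)) v :=
    (contMDiffAt_symm_of_mem_maximalAtlas he.mem_maximalAtlas hv1).comp v
      L.contDiff.contMDiff.contMDiffAt
  have h2 : ContMDiffAt 𝓘(ℝ, V) 𝓘(ℝ, EG) ∞ (fun v => (h : G)⁻¹ * (g * e.symm (L v))) v :=
    contMDiffAt_const.mul (contMDiffAt_const.mul h1)
  have h3 : ContMDiffAt 𝓘(ℝ, V) 𝓘(ℝ, EG) ∞ (fun v => e ((h : G)⁻¹ * (g * e.symm (L v)))) v :=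
    (contMDiffAt_of_mem_maximalAtlas he.mem_maximalAtlas hv2).comp v h2
  have h4 : ContDiffAt ℝ ∞ (fun v => P (e ((h : G)⁻¹ * (g * e.symm (L v))))) v :=
    P.contDiff.contDiffAt.comp v h3.contDiffAt
  refine h4.contDiffWithinAt.congr (fun w hw => ?_) ?_
  · simp only [mfld_simps] at hw
    exact heq w hw.1
  · exact heq v hv1

/-- In left-translated charts of `H` and `G` the inclusion is the linear map `L`, with `ker P` as
complement of its range. -/
theorem isImmersion :
    letI := he.chartedSpace hPL hL
    IsImmersion 𝓘(ℝ, V) 𝓘(ℝ, EG) ∞ (Subtype.val : H → G) := by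
  let := he.chartedSpace hPL hL
  have := he.isManifold hPL hL
  refine ⟨P.toLinearMap.ker, inferInstance, inferInstance, fun x => ?_⟩
  refine IsImmersionAtOfComplement.mk_of_continuousAt continuous_subtype_val.continuousAt
    (ContinuousLinearEquiv.equivOfRightInverse P L hPL).symm (he.translatedChart hPL hL x)
    ((Homeomorph.mulLeft (x : G)⁻¹).transOpenPartialHomeomorph e) (mem_chart_source V x) ?_
    (IsManifold.chart_mem_maximalAtlas x) ?_ ?_
  · simpa using he.one_mem_source
  · rw [IsManifold.mem_maximalAtlas_iff_contMDiffOn]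
    constructor
    · exact (contMDiffOn_of_mem_maximalAtlas he.mem_maximalAtlas).comp
        (contMDiff_mul_left (a := (x : G)⁻¹)).contMDiffOn fun g hg => hg
    · refine ((contMDiff_mul_left (a := (x : G))).comp_contMDiffOn
        (contMDiffOn_symm_of_mem_maximalAtlas he.mem_maximalAtlas)).congr fun v _ => ?_
      change (Homeomorph.mulLeft (x : G)⁻¹).symm (e.symm v) = x * e.symm v
      rw [Homeomorph.mulLeft_symm, inv_inv]
      rfl
  · intro v hv
    have hv1 : L v ∈ e.target := by
      simpa only [mfld_simps] using! hv
    change e ((x : G)⁻¹ * ((he.translatedChart hPL hL x).symm v : H)) = _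
    rw [he.coe_translatedChart_symm hPL hL x hv1, inv_mul_cancel_left, e.right_inv hv1]
    simp

/-- A continuous map into `H` is smooth once its composition with the immersion into `G` is smooth,
so the operations inherit smoothness from `G`. -/
theorem lieGroup :
    letI := he.chartedSpace hPL hL
    LieGroup 𝓘(ℝ, V) ∞ H := by
  let := he.chartedSpace hPL hL
  have := he.isManifold hPL hL
  have hι := he.isImmersion hPL hL
  refine { contMDiff_mul := ?_, contMDiff_inv := ?_ }
  · rw [ContMDiff.iff_comp_isImmersion hι]
    exact ⟨continuous_mul, (hι.contMDiff.comp contMDiff_fst).mul (hι.contMDiff.comp contMDiff_snd)⟩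
  · rw [ContMDiff.iff_comp_isImmersion hι]
    exact ⟨continuous_inv, hι.contMDiff.inv⟩

/-- The derivative of `e` at the identity is the identity, so `D` is also the derivative of `e`
restricted to `H`. From `e = L ∘ P ∘ e` on `H` the range of `D` lies in that of `L`; from `e ∘ c⁻¹ =
L` near `0` the converse follows. -/
theorem range_mfderiv_val :
    letI := he.chartedSpace hPL hL
    (range (mfderiv 𝓘(ℝ, V) 𝓘(ℝ, EG) (Subtype.val : H → G) 1) : Set EG) = 𝔥 := by
  let := he.chartedSpace hPL hL
  have := he.isManifold hPL hL
  have hι : ContMDiff 𝓘(ℝ, V) 𝓘(ℝ, EG) ∞ (Subtype.val : H → G) := (he.isImmersion hPL hL).contMDiff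
  let D : V →L[ℝ] EG := mfderiv 𝓘(ℝ, V) 𝓘(ℝ, EG) (Subtype.val : H → G) 1
  have hd : HasMFDerivAt 𝓘(ℝ, V) 𝓘(ℝ, EG) (Subtype.val : H → G) 1 D :=
    ((hι 1).mdifferentiableAt (by simp)).hasMFDerivAt
  have hed : HasMFDerivAt 𝓘(ℝ, V) 𝓘(ℝ, EG) (fun x : H => e x) 1 D :=
    (HasMFDerivAt.comp (1 : H) he.hasMFDerivAt hd).congr_mfderiv (ContinuousLinearMap.id_comp D)
  have hLP : HasMFDerivAt 𝓘(ℝ, V) 𝓘(ℝ, EG) (fun x : H => L (P (e x))) 1 ((L.comp P).comp D) :=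
    HasMFDerivAt.comp (g := fun y => L (P y)) (1 : H)
      ((L.comp P).hasFDerivAt (x := e ((1 : H) : G))).hasMFDerivAt hed
  have hS : ∀ᶠ x : H in 𝓝 1, (x : G) ∈ e.source :=
    continuous_subtype_val.continuousAt.preimage_mem_nhds
      (e.open_source.mem_nhds he.one_mem_source)
  have hDL : D = (L.comp P).comp D := hasMFDerivAt_unique hed (hLP.congr_of_eventuallyEq (by
    filter_upwards [hS] with x hx
    exact (he.map_proj hPL hL hx x.2).symm))
  have h0t : (0 : EG) ∈ e.target := he.map_one ▸ e.map_source he.one_mem_source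
  have h0t' : L 0 ∈ e.target := by rwa [map_zero]
  have he0 : e.symm 0 = 1 := by rw [← he.map_one, e.left_inv he.one_mem_source]
  set c := he.translatedChart hPL hL 1
  have hc0 : c.symm 0 = 1 := by
    apply Subtype.ext
    rw [he.coe_translatedChart_symm hPL hL 1 h0t', map_zero, he0]
    simp
  have hcd : MDifferentiableAt 𝓘(ℝ, V) 𝓘(ℝ, V) c.symm (0 : V) :=
    (contMDiffAt_symm_of_mem_maximalAtlas (n := ∞) (IsManifold.chart_mem_maximalAtlas (1 : H))
      h0t').mdifferentiableAt (by simp)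
  let A : V →L[ℝ] V := mfderiv 𝓘(ℝ, V) 𝓘(ℝ, V) c.symm (0 : V)
  have hA : HasMFDerivAt 𝓘(ℝ, V) 𝓘(ℝ, V) c.symm (0 : V) A := hcd.hasMFDerivAt
  have hDA : HasMFDerivAt 𝓘(ℝ, V) 𝓘(ℝ, EG) (fun v => e (c.symm v : H)) (0 : V) (D.comp A) :=
    HasMFDerivAt.comp (0 : V) (g := fun x : H => e x) (by rw [hc0]; exact hed) hA
  have hDAL : D.comp A = L := hasMFDerivAt_unique hDA
    ((L.hasFDerivAt (x := 0)).hasMFDerivAt.congr_of_eventuallyEq (by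
      filter_upwards [L.continuous.continuousAt.preimage_mem_nhds
        (e.open_target.mem_nhds h0t')] with v hv
      rw [he.coe_translatedChart_symm hPL hL 1 hv]
      simp [e.right_inv hv]))
  have hrange : range D = (L.toLinearMap.range : Set EG) := by
    ext x
    constructor
    · rintro ⟨v, rfl⟩
      exact ⟨P (D v), (DFunLike.congr_fun hDL v).symm⟩
    · rintro ⟨v, rfl⟩
      exact ⟨A v, DFunLike.congr_fun hDAL v⟩
  exact hrange.trans (congrArg SetLike.coe hL)

end IsSliceChart

/-! ### The Lie algebra of a closed subgroup is a Lie subalgebra -/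

theorem Submodule.mem_of_hasDerivAt {V : Type*} [NormedAddCommGroup V] [NormedSpace ℝ V]
    {S : Submodule ℝ V} (hS : IsClosed (S : Set V)) {c : ℝ → V} {c' : V} {t : ℝ}
    (hc : HasDerivAt c c' t) (hmem : ∀ᶠ s in 𝓝 t, c s ∈ S) : c' ∈ S := by
  refine hS.mem_of_tendsto (hasDerivAt_iff_tendsto_slope.1 hc) ?_
  filter_upwards [hmem.filter_mono nhdsWithin_le_nhds] with s hs
  exact S.smul_mem _ (S.sub_mem hs hmem.self_of_nhds)

theorem Submodule.fderiv_apply_mem {V : Type*} [NormedAddCommGroup V] [NormedSpace ℝ V]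
    {S : Submodule ℝ V} (hS : IsClosed (S : Set V)) {X : V → V}
    (hX : ∀ᶠ x in 𝓝 0, x ∈ S → X x ∈ S) {v : V} (hv : v ∈ S) : fderiv ℝ X 0 v ∈ S := by
  by_cases hd : DifferentiableAt ℝ X 0
  · have hline : HasDerivAt (fun t : ℝ => t • v) v 0 := by
      simpa using (hasDerivAt_id (0 : ℝ)).smul_const v
    have hcomp : HasDerivAt (fun t : ℝ => X (t • v)) (fderiv ℝ X 0 v) 0 :=
      HasFDerivAt.comp_hasDerivAt (0 : ℝ) (by rw [zero_smul]; exact hd.hasFDerivAt) hline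
    refine Submodule.mem_of_hasDerivAt hS hcomp ?_
    have ht : Tendsto (fun t : ℝ => t • v) (𝓝 0) (𝓝 0) := by
      simpa using hline.continuousAt.tendsto
    filter_upwards [ht.eventually hX] with t h
    exact h (S.smul_mem t hv)
  -- Without differentiability `fderiv` is `0` by convention, so callers need not prove it.
  · rw [fderiv_zero_of_not_differentiableAt hd]
    exact S.zero_mem

namespace IsSliceChart

variable {EG : Type*} [NormedAddCommGroup EG] [NormedSpace ℝ EG] [FiniteDimensional ℝ EG]
  {G : Type*} [TopologicalSpace G] [T2Space G] [ChartedSpace EG G] [Group G]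
  [LieGroup 𝓘(ℝ, EG) ∞ G] {H : Subgroup G} {𝔥 : Submodule ℝ EG} {e : OpenPartialHomeomorph G EG}

/-- In a slice chart, the left-invariant vector fields generated by the Lie algebra of `H` are
tangent to `H`. -/
theorem mpullback_mulInvariantVectorField_mem (he : IsSliceChart H 𝔥 e)
    {ξ : GroupLieAlgebra 𝓘(ℝ, EG) G} (hξ : ∀ t, expCurve ξ t ∈ H) {x : EG} (hx : x ∈ e.target)
    (hx𝔥 : x ∈ 𝔥) :
    (VectorField.mpullback 𝓘(ℝ, EG) 𝓘(ℝ, EG) e.symm (mulInvariantVectorField ξ) x : EG) ∈ 𝔥 := by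
  set g := e.symm x with hg
  have hgs : g ∈ e.source := e.map_target hx
  have hgx : e g = x := e.right_inv hx
  have hgH : g ∈ H := (he.mem_iff g hgs).2 (hgx ▸ hx𝔥)
  let A : EG →L[ℝ] EG := mfderiv 𝓘(ℝ, EG) 𝓘(ℝ, EG) e.symm x
  let B : EG →L[ℝ] EG := mfderiv 𝓘(ℝ, EG) 𝓘(ℝ, EG) e g
  have hA : HasMFDerivAt 𝓘(ℝ, EG) 𝓘(ℝ, EG) e.symm x A :=
    ((contMDiffAt_symm_of_mem_maximalAtlas he.mem_maximalAtlas hx).mdifferentiableAt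
      (by simp)).hasMFDerivAt
  have hB : HasMFDerivAt 𝓘(ℝ, EG) 𝓘(ℝ, EG) e g B :=
    ((contMDiffAt_of_mem_maximalAtlas he.mem_maximalAtlas hgs).mdifferentiableAt
      (by simp)).hasMFDerivAt
  have hBA : B.comp A = ContinuousLinearMap.id ℝ EG :=
    hasMFDerivAt_unique (HasMFDerivAt.comp x hB hA)
      ((hasMFDerivAt_id x).congr_of_eventuallyEq (by
        filter_upwards [e.open_target.mem_nhds hx] with y hy
        exact e.right_inv hy))
  have hAB : A.comp B = ContinuousLinearMap.id ℝ EG :=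
    hasMFDerivAt_unique (HasMFDerivAt.comp g (by rw [hgx]; exact hA) hB)
      ((hasMFDerivAt_id g).congr_of_eventuallyEq (by
        filter_upwards [e.open_source.mem_nhds hgs] with y hy
        exact e.left_inv hy))
  -- Pulling back along `e.symm` applies the inverse of its derivative, which is the derivative of
  -- `e`. The value is thus the velocity of `t ↦ e (g * expCurve ξ t)`, a curve in `𝔥`.
  have hinv : A.inverse = B := ContinuousLinearMap.inverse_eq hAB hBA
  have hval : (VectorField.mpullback 𝓘(ℝ, EG) 𝓘(ℝ, EG) e.symm (mulInvariantVectorField ξ) x : EG) =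
      B (mulInvariantVectorField ξ g : EG) :=
    DFunLike.congr_fun hinv (mulInvariantVectorField ξ g : EG)
  rw [hval]
  have hcurve := (isMIntegralCurve_expCurve ξ).mul_left g 0
  have hg0 : g * expCurve ξ 0 = g := by rw [expCurve_zero, mul_one]
  have hcomp : HasFDerivAt (fun t => e (g * expCurve ξ t))
      (B.comp ((1 : ℝ →L[ℝ] ℝ).smulRight (mulInvariantVectorField ξ (g * expCurve ξ 0) : EG))) 0 :=
    (HasMFDerivAt.comp (g := e) (0 : ℝ) (by rw [hg0]; exact hB) hcurve).hasFDerivAt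
  have hder : HasDerivAt (fun t => e (g * expCurve ξ t))
      (B (mulInvariantVectorField ξ g : EG)) 0 := by
    refine hcomp.hasDerivAt.congr_deriv ?_
    have key : ∀ g' : G, g' = g →
        (mulInvariantVectorField ξ g' : EG) = mulInvariantVectorField ξ g := by
      rintro _ rfl
      rfl
    rw [key _ hg0]
    exact congrArg B (one_smul ℝ (mulInvariantVectorField ξ g : EG))
  refine Submodule.mem_of_hasDerivAt 𝔥.closed_of_finiteDimensional hder ?_
  have : IsTopologicalGroup G := topologicalGroup_of_lieGroup 𝓘(ℝ, EG) ∞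
  have hcont : ContinuousAt (fun t => g * expCurve ξ t) 0 :=
    (continuous_const.mul (continuous_expCurve ξ)).continuousAt
  filter_upwards [hcont.preimage_mem_nhds (e.open_source.mem_nhds (by rwa [hg0]))] with t ht
  exact (he.mem_iff _ ht).1 (H.mul_mem hgH (hξ t))

/-- Brackets commute with pullback to the slice chart. There the bracket is `DY(X) - DX(Y)`, and
both terms stay in `𝔥` when `X` and `Y` map `𝔥` to itself near `0`. -/
theorem mlieBracket_mem (he : IsSliceChart H 𝔥 e) {ξ η : GroupLieAlgebra 𝓘(ℝ, EG) G}
    (hξ : ∀ t, expCurve ξ t ∈ H) (hη : ∀ t, expCurve η t ∈ H) :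
    (VectorField.mlieBracket 𝓘(ℝ, EG) (mulInvariantVectorField ξ) (mulInvariantVectorField η)
      (1 : G) : EG) ∈ 𝔥 := by
  have : CompleteSpace EG := FiniteDimensional.complete ℝ EG
  have h0t : (0 : EG) ∈ e.target := he.map_one ▸ e.map_source he.one_mem_source
  have he0 : e.symm 0 = 1 := by rw [← he.map_one, e.left_inv he.one_mem_source]
  let A : EG →L[ℝ] EG := mfderiv 𝓘(ℝ, EG) 𝓘(ℝ, EG) e.symm (0 : EG)
  have hA : HasMFDerivAt 𝓘(ℝ, EG) 𝓘(ℝ, EG) e.symm (0 : EG) A :=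
    ((contMDiffAt_symm_of_mem_maximalAtlas he.mem_maximalAtlas h0t).mdifferentiableAt
      (by simp)).hasMFDerivAt
  -- Hence the pullback at `0` leaves the vector at the identity unchanged.
  have hAid : A = ContinuousLinearMap.id ℝ EG :=
    hasMFDerivAt_unique (HasMFDerivAt.comp (0 : EG) (by rw [he0]; exact he.hasMFDerivAt) hA)
      ((hasMFDerivAt_id (0 : EG)).congr_of_eventuallyEq (by
        filter_upwards [e.open_target.mem_nhds h0t] with y hy
        exact e.right_inv hy))
  have hpull := VectorField.mpullback_mlieBracket (I := 𝓘(ℝ, EG)) (I' := 𝓘(ℝ, EG))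
    (n := ∞) (f := e.symm) (x₀ := (0 : EG))
    (mdifferentiableAt_mulInvariantVectorField ξ) (mdifferentiableAt_mulInvariantVectorField η)
    (contMDiffAt_symm_of_mem_maximalAtlas he.mem_maximalAtlas h0t)
    (by rw [minSmoothness_of_isRCLikeNormedField]; exact ENat.LEInfty.out)
  have hmem : ∀ ζ : GroupLieAlgebra 𝓘(ℝ, EG) G, (∀ t, expCurve ζ t ∈ H) → ∀ᶠ x in 𝓝 (0 : EG),
      x ∈ 𝔥 → (VectorField.mpullback 𝓘(ℝ, EG) 𝓘(ℝ, EG) e.symm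
        (mulInvariantVectorField ζ) x : EG) ∈ 𝔥 := by
    intro ζ hζ
    filter_upwards [e.open_target.mem_nhds h0t] with x hx hx𝔥
    exact he.mpullback_mulInvariantVectorField_mem hζ hx hx𝔥
  have hcl := 𝔥.closed_of_finiteDimensional
  have hright : (VectorField.mlieBracket 𝓘(ℝ, EG)
      (VectorField.mpullback 𝓘(ℝ, EG) 𝓘(ℝ, EG) e.symm (mulInvariantVectorField ξ))
      (VectorField.mpullback 𝓘(ℝ, EG) 𝓘(ℝ, EG) e.symm (mulInvariantVectorField η))
      (0 : EG) : EG) ∈ 𝔥 := by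
    have hflat : ∀ X Y : (x : EG) → TangentSpace 𝓘(ℝ, EG) x,
        VectorField.mlieBracket 𝓘(ℝ, EG) X Y = VectorField.lieBracket ℝ X Y := fun X Y =>
      VectorField.mlieBracketWithin_univ.symm.trans
        (VectorField.mlieBracketWithin_eq_lieBracketWithin.trans VectorField.lieBracketWithin_univ)
    refine (congrArg (· ∈ 𝔥) (congrFun (hflat _ _) 0)).mpr ?_
    exact 𝔥.sub_mem
      (Submodule.fderiv_apply_mem hcl (hmem η hη) ((hmem ξ hξ).self_of_nhds 𝔥.zero_mem))
      (Submodule.fderiv_apply_mem hcl (hmem ξ hξ) ((hmem η hη).self_of_nhds 𝔥.zero_mem))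
  rw [← hpull] at hright
  have hinv : ∀ w : EG, A.inverse w = w := by
    intro w
    rw [hAid, ContinuousLinearMap.inverse_id]
    rfl
  have hleft : (VectorField.mpullback 𝓘(ℝ, EG) 𝓘(ℝ, EG) e.symm
      (VectorField.mlieBracket 𝓘(ℝ, EG) (mulInvariantVectorField ξ) (mulInvariantVectorField η))
      (0 : EG) : EG) = (VectorField.mlieBracket 𝓘(ℝ, EG) (mulInvariantVectorField ξ)
        (mulInvariantVectorField η) (e.symm 0) : EG) := hinv _
  have key : ∀ g : G, g = 1 → (VectorField.mlieBracket 𝓘(ℝ, EG) (mulInvariantVectorField ξ)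
      (mulInvariantVectorField η) g : EG) = (VectorField.mlieBracket 𝓘(ℝ, EG)
        (mulInvariantVectorField ξ) (mulInvariantVectorField η) (1 : G) : EG) := by
    rintro _ rfl
    rfl
  rw [← key _ he0]
  exact hleft ▸ hright

end IsSliceChart

/-! ### Cartan's closed subgroup theorem -/

section ClosedSubgroup

variable {EG : Type*} [NormedAddCommGroup EG] [NormedSpace ℝ EG] [FiniteDimensional ℝ EG]
  {G : Type*} [TopologicalSpace G] [T2Space G] [ChartedSpace EG G] [Group G]
  [LieGroup 𝓘(ℝ, EG) ∞ G]

/-- A closed subgroup of a Lie group is an embedded Lie subgroup, and its Lie algebra is the Lie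
subalgebra of all generators of one-parameter subgroups of it. -/
theorem exists_embeddedLieSubgroupStructure (H : Subgroup G) (hH : IsClosed (H : Set G)) :
    ∃ (S : EmbeddedLieSubgroupStructure (EG := EG) H)
      (𝔥 : LieSubalgebra ℝ (GroupLieAlgebra 𝓘(ℝ, EG) G)),
      (𝔥 : Set (GroupLieAlgebra 𝓘(ℝ, EG) G)) = S.lieAlgebra ∧
      S.lieAlgebra = {ξ : GroupLieAlgebra 𝓘(ℝ, EG) G | ∀ t, expCurve ξ t ∈ H} := by
  have : CompleteSpace EG := FiniteDimensional.complete ℝ EG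
  have : IsTopologicalGroup G := topologicalGroup_of_lieGroup 𝓘(ℝ, EG) ∞
  obtain ⟨𝔥, e, he, mem𝔥⟩ := exists_isSliceChart (EG := EG) H hH
  obtain ⟨P₀, hP₀⟩ := Submodule.ClosedComplemented.of_finiteDimensional 𝔥
  let L₀ : EuclideanSpace ℝ (Fin (Module.finrank ℝ 𝔥)) ≃L[ℝ] 𝔥 :=
    ContinuousLinearEquiv.ofFinrankEq (by simp)
  let L : EuclideanSpace ℝ (Fin (Module.finrank ℝ 𝔥)) →L[ℝ] EG :=
    𝔥.subtypeL.comp (L₀ : EuclideanSpace ℝ (Fin (Module.finrank ℝ 𝔥)) →L[ℝ] 𝔥)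
  let P : EG →L[ℝ] EuclideanSpace ℝ (Fin (Module.finrank ℝ 𝔥)) :=
    (L₀.symm : 𝔥 →L[ℝ] EuclideanSpace ℝ (Fin (Module.finrank ℝ 𝔥))).comp P₀
  have hPL : Function.RightInverse L P := fun v => by
    change L₀.symm (P₀ (L₀ v : EG)) = v
    rw [hP₀, L₀.symm_apply_apply]
  have hL : L.toLinearMap.range = 𝔥 := by
    ext x
    constructor
    · rintro ⟨v, rfl⟩
      exact (L₀ v).2
    · intro hx
      exact ⟨L₀.symm ⟨x, hx⟩, congrArg Subtype.val (L₀.apply_symm_apply ⟨x, hx⟩)⟩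
  let S : EmbeddedLieSubgroupStructure (EG := EG) H :=
    { dim := Module.finrank ℝ 𝔥
      chartedSpace := he.chartedSpace hPL hL
      lieGroup := he.lieGroup hPL hL
      isSmoothEmbedding :=
        letI := he.chartedSpace hPL hL
        ⟨he.isImmersion hPL hL, IsEmbedding.subtypeVal⟩ }
  have hS : S.lieAlgebra = {ξ : GroupLieAlgebra 𝓘(ℝ, EG) G | ∀ t, expCurve ξ t ∈ H} :=
    Eq.trans (he.range_mfderiv_val hPL hL) (Set.ext mem𝔥)
  exact ⟨S, { H.expSubmodule hH with
    lie_mem' := fun {ξ η} hξ hη => (mem𝔥 _).1 (he.mlieBracket_mem hξ hη) }, hS.symm, hS⟩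

end ClosedSubgroup

/-! ### The symmetry group of a continuous section -/

/-- Each fiber is homeomorphic to `W`. This gives closed equality sets and unique pointwise limits,
the latter being needed to evaluate `limUnder`. -/
theorem FiberBundle.t2Space_fiber {M : Type*} [TopologicalSpace M]
    (W : Type*) [NormedAddCommGroup W] [NormedSpace ℝ W]
    (E : M → Type*) [∀ p, AddCommGroup (E p)] [∀ p, Module ℝ (E p)] [∀ p, TopologicalSpace (E p)]
    [TopologicalSpace (TotalSpace W E)] [FiberBundle W E] [VectorBundle ℝ W E] (p : M) :
    T2Space (E p) :=
  ((trivializationAt W E p).continuousLinearEquivAt ℝ p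
    (FiberBundle.mem_baseSet_trivializationAt W E p)).toHomeomorph.symm.t2Space

namespace FiberLinearAction

variable {EM : Type*} [NormedAddCommGroup EM] [NormedSpace ℝ EM]
  {M : Type*} [TopologicalSpace M] [ChartedSpace EM M]
  {W : Type*} [NormedAddCommGroup W] [NormedSpace ℝ W]
  {E : M → Type*} [∀ p, AddCommGroup (E p)] [∀ p, Module ℝ (E p)]
  [∀ p, TopologicalSpace (E p)] [TopologicalSpace (TotalSpace W E)] [FiberBundle W E]
  {EG : Type*} [NormedAddCommGroup EG] [NormedSpace ℝ EG]
  {G : Type*} [TopologicalSpace G] [ChartedSpace EG G] [Group G]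
  (A : FiberLinearAction (EM := EM) W E (EG := EG) G)

theorem continuous_total : Continuous fun x : TotalSpace W E × G => A.total x.1 x.2 :=
  A.contMDiff_total.continuous

/-- The base action is the projection of the action on zero vectors. -/
theorem continuous_base (p : M) : Continuous (A.base p) :=
  (FiberBundle.continuous_proj W E).comp
    (A.continuous_total.comp (Continuous.prodMk_right (⟨p, 0⟩ : TotalSpace W E)))

theorem continuous_transform [ContinuousInv G] {F : ∀ p, E p}
    (hF : Continuous fun p => TotalSpace.mk' W p (F p)) (p : M) :
    Continuous fun g => A.transform g F p := by
  rw [(FiberBundle.totalSpaceMk_isInducing W E p).continuous_iff]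
  have h : Continuous fun g => A.total (TotalSpace.mk' W (A.base p g) (F (A.base p g))) g⁻¹ :=
    A.continuous_total.comp ((hF.comp (A.continuous_base p)).prodMk continuous_inv)
  exact h.congr fun g => (A.mk_transform g F p).symm

/-- The operator `K_g` is given by a continuous linear map on fibers. -/
theorem exists_transform_eq (g : G) (p : M) :
    ∃ T : E (A.base p g) →L[ℝ] E p, ∀ F : ∀ p, E p, A.transform g F p = T (F (A.base p g)) := by
  -- Generalizing the endpoint makes the transport along `θ_{g⁻¹} (θ_g p) = p` disappear.
  have key : ∀ (x q : M) (h : q = p) (T : E x →ₗ[ℝ] E q),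
      ∃ T' : E x →ₗ[ℝ] E p, (∀ v, h ▸ T v = T' v) ∧
        ∀ v, (⟨p, T' v⟩ : TotalSpace W E) = ⟨q, T v⟩ := by
    rintro x q rfl T
    exact ⟨T, fun _ => rfl, fun _ => rfl⟩
  obtain ⟨T', hT', hT''⟩ := key _ _ (A.base_base_inv p g) (A.fiberMap (A.base p g) g⁻¹)
  refine ⟨⟨T', ?_⟩, fun F => hT' _⟩
  rw [(FiberBundle.totalSpaceMk_isInducing W E p).continuous_iff]
  have h : Continuous fun v : E (A.base p g) => A.total (TotalSpace.mk' W (A.base p g) v) g⁻¹ :=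
    A.continuous_total.comp ((FiberBundle.continuous_totalSpaceMk W E _).prodMk continuous_const)
  exact h.congr fun v => (hT'' v).symm

variable [VectorBundle ℝ W E]

theorem isClosed_symmetryGroup [ContinuousInv G] {F : ∀ p, E p}
    (hF : Continuous fun p => TotalSpace.mk' W p (F p)) :
    IsClosed (A.symmetryGroup F : Set G) := by
  have hT := FiberBundle.t2Space_fiber W E
  have h : (A.symmetryGroup F : Set G) = ⋂ p, {g | A.transform g F p = F p} := by
    ext g
    simp only [mem_iInter, mem_ofPred_eq]
    exact funext_iff
  rw [h]
  exact isClosed_iInter fun p => isClosed_eq (A.continuous_transform hF p) continuous_const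

variable [FiniteDimensional ℝ EG] [T2Space G] [LieGroup 𝓘(ℝ, EG) ∞ G]

/-- By the group law, `K_{exp((t+s)ξ)} F - K_{exp(tξ)} F = K_{exp(tξ)} (K_{exp(sξ)} F - F)`. At `p`
this is a continuous linear fiber map applied to the difference at the moved point `θ(p, exp(tξ))`,
so a vanishing pointwise limit at time `0` gives a vanishing derivative at every time. -/
theorem mem_lieDerivDomain_and_lieDeriv_eq_zero_iff (ξ : GroupLieAlgebra 𝓘(ℝ, EG) G)
    (F : ∀ p, E p) :
    F ∈ A.lieDerivDomain ξ ∧ A.lieDeriv ξ F = 0 ↔ ∀ t, expCurve ξ t ∈ A.symmetryGroup F := by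
  have hT := FiberBundle.t2Space_fiber W E
  constructor
  · rintro ⟨⟨Y, hY⟩, h0⟩
    rw [lieDeriv, hY.limUnder_eq] at h0
    subst h0
    have hq : ∀ p, Tendsto (fun s : ℝ => s⁻¹ • (A.transform (expCurve ξ s) F p - F p)) (𝓝[≠] 0)
        (𝓝 0) := fun p => by
      refine (tendsto_pi_nhds.1 hY p).congr fun s => ?_
      simp only [lieQuotient, lieExp_smul]
      rfl
    intro t
    change A.transform (expCurve ξ t) F = F
    funext p
    -- The fiber carries only a topology; passing to the normed space `W` makes calculus available.
    let φ : E p ≃L[ℝ] W := (trivializationAt W E p).continuousLinearEquivAt ℝ p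
      (FiberBundle.mem_baseSet_trivializationAt W E p)
    have hder : ∀ t, HasDerivAt (fun t => φ (A.transform (expCurve ξ t) F p)) 0 t := by
      intro t
      obtain ⟨T, hT⟩ := A.exists_transform_eq (expCurve ξ t) p
      rw [hasDerivAt_iff_tendsto_slope_zero]
      have h1 := ((φ.continuous.comp T.continuous).tendsto' 0 0 (by simp)).comp
        (hq (A.base p (expCurve ξ t)))
      refine h1.congr fun s => ?_
      simp only [Function.comp_apply]
      rw [expCurve_add, A.transform_mul, hT, hT, map_smul, map_smul, map_sub, map_sub]
    have hconst := is_const_of_deriv_eq_zero (fun t => (hder t).differentiableAt)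
      (fun t => (hder t).deriv) t 0
    rw [φ.injective.eq_iff, expCurve_zero, A.transform_one] at hconst
    exact hconst
  · intro h
    have hq : A.lieQuotient ξ F = fun _ => 0 := by
      funext t
      rw [lieQuotient, lieExp_smul]
      have : A.transform (expCurve ξ t) F = F := h t
      rw [this, sub_self, smul_zero]
    have hlim : Tendsto (A.lieQuotient ξ F) (𝓝[≠] 0) (𝓝 0) := by
      rw [hq]
      exact tendsto_const_nhds
    exact ⟨⟨0, hlim⟩, hlim.limUnder_eq⟩

end FiberLinearAction

theorem mainTheorem1
    {EG : Type*} [NormedAddCommGroup EG] [NormedSpace ℝ EG] [FiniteDimensional ℝ EG]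
    {G : Type*} [TopologicalSpace G] [T2Space G] [ChartedSpace EG G] [Group G]
    [LieGroup 𝓘(ℝ, EG) ∞ G]
    {EM : Type*} [NormedAddCommGroup EM] [NormedSpace ℝ EM] [FiniteDimensional ℝ EM]
    {M : Type*} [TopologicalSpace M] [T2Space M] [ChartedSpace EM M] [IsManifold 𝓘(ℝ, EM) ∞ M]
    {W : Type*} [NormedAddCommGroup W] [NormedSpace ℝ W] [FiniteDimensional ℝ W]
    {E : M → Type*} [∀ p, AddCommGroup (E p)] [∀ p, Module ℝ (E p)]
    [∀ p, TopologicalSpace (E p)] [TopologicalSpace (TotalSpace W E)] [FiberBundle W E]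
    [VectorBundle ℝ W E] [ContMDiffVectorBundle ∞ W E 𝓘(ℝ, EM)]
    (A : FiberLinearAction (EM := EM) W E (EG := EG) G)
    (F : ∀ p, E p) (hF : Continuous fun p => TotalSpace.mk' W p (F p)) :
    IsClosed (A.symmetryGroup F : Set G) ∧
    ∃ (S : EmbeddedLieSubgroupStructure (EG := EG) (A.symmetryGroup F))
      (𝔥 : LieSubalgebra ℝ (GroupLieAlgebra 𝓘(ℝ, EG) G)),
      (𝔥 : Set (GroupLieAlgebra 𝓘(ℝ, EG) G)) = S.lieAlgebra ∧
      S.lieAlgebra =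
        {ξ : GroupLieAlgebra 𝓘(ℝ, EG) G | F ∈ A.lieDerivDomain ξ ∧ A.lieDeriv ξ F = 0} := by
  have : IsTopologicalGroup G := topologicalGroup_of_lieGroup 𝓘(ℝ, EG) ∞
  have hH := A.isClosed_symmetryGroup hF
  obtain ⟨S, 𝔥, h𝔥, hS⟩ := exists_embeddedLieSubgroupStructure (EG := EG) (A.symmetryGroup F) hH
  refine ⟨hH, S, 𝔥, h𝔥, hS.trans (Set.ext fun ξ => ?_)⟩
  exact (A.mem_lieDerivDomain_and_lieDeriv_eq_zero_iff ξ F).symm
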